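/- **Model.** Agents $z\in[-1,1]$ are distributed uniformly, with law $F$ of density $\tfrac12$. Given a radius $r>0$, the neighbourhood of $z$ is $R(z)=\{u\in[-1,1]:|z-u|<r\}$, and for a function $f$ write $\bar f(z)=\frac1{F(R(z))}\int_{R(z)}f\,dF$. For a treatment assignment $d:[-1,1]\to\{0,1\}$, the outcome function $Y_d$ is the integrable solution on $[-1,1]$ of $$Y_d=d\,Y_d^++(1-d)\,Y_d^-,\qquad Y_d^{\pm}(z)=m^{\pm}(z)+\delta(z)\,\overline{Y_d}(z)+\gamma(z)\,\bar d(z),$$ where $m^+,m^-$ are Lipschitz on $[-1,1]$, $\delta,\gamma$ are continuously differentiable with $|\delta'|<C_\delta$, $|\gamma'|<C_\gamma$, and $\sup_z|\delta(z)|\le\bar\delta$, $\sup_{z_1,z_2}|\delta(z_1)-\delta(z_2)|\le\bar\delta$ for some $\bar\delta<1$. The radius is $r=r_n>0$, and the observed assignment is $d(z)=\mathbf 1\{z\ge0\}$. Put $\tau_d=m^+(0)-m^-(0)$ $(=Y_d^+(0)-Y_d^-(0))$ and let $\tau_{TOT,n}=Y^+_{\mathbf 1}(0)-Y^-_{\mathbf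 0}(0)$ be the difference between the treated outcome at $0$ when everyone is treated and the control outcome at $0$ when no one is treated (radius $r_n$). **Sampling and estimator.** For each $n$ we observe an i.i.d. sample $(Y_i,Z_i)_{i\le n}$ with $Z_i\sim F$, $Y_i=Y_d(Z_i)+\varepsilon_i$, $E[\varepsilon_i\mid Z_i]=0$, $E[\varepsilon_i^2\mid Z_i]\le\bar\sigma^2$ ($\bar\sigma$ not depending on $n$). Let $K$ be measurable with $0\le K\le\bar K$, $K=0$ outside $[-1,1]$, $\int_{-1}^1K=1$, $\int_{-1}^1uK(u)\,du=0$, and let $h_n>0$, $h_n\to0$, $nh_n\to\infty$. Let $(\hat\beta_0^+,\hat\beta_1^+)$ minimize $\sum_{Z_i\ge0}K(Z_i/h_n)(Y_i-b_0-b_1Z_i)^2$ over $b\in\mathbb R^2$, let $(\hat\beta_0^-,\hat\beta_1^-)$ minimize the same sum over $Z_i<0$ (any minimizers), and $\hat\tau_{RDD}=\hat\beta_0^+-\hat\beta_0^-$. **Theorem.** As $n\to\infty$: (a) If $r_n/h_n\to\infty$, then $\hat\tau_{RDD}\to\tau_d$ in probability. (b) If $r_n/h_n\to0$, then $\hat\tau_{RDD}\to\tau_{TOT}:=\dfrac{\tau_d+\gamma(0)}{1-\delta(0)}$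 in probability, and $\tau_{TOT,n}\to\tau_{TOT}$. (c) If $2r_n/h_n\to c$ with $0<c<\infty$, then $\hat\tau_{RDD}\to\tau_*$ in probability, where $$\tau_*=\tau_d+\delta(0)\tau_d\big(T^+(\Lambda^+)-T^-(\Lambda^-)\big)+\delta(0)\gamma(0)\big(T^+(\tilde\Lambda^+)-T^-(\tilde\Lambda^-)\big)+\gamma(0)\big(T^+(\Gamma^+)-T^-(\Gamma^-)\big)$$ with the following notation. Kernel moments: $\gamma^+_p=\int_0^1x^pK(x)\,dx$, $\gamma^-_p=\int_{-1}^0x^pK(x)\,dx$, and $T^\pm(I)=\dfrac{\gamma_2^\pm I_0-\gamma_1^\pm I_1}{\gamma_2^\pm\gamma_0^\pm-(\gamma_1^\pm)^2}$ for a pair $I=(I_0,I_1)$. Let $(Gf)(a)=\frac12\int_{a-1}^{a+1}f(u)\,du$ on functions on $\mathbb R$, $\tilde d(a)=\max\{0,\min\{1,\frac{a+1}2\}\}$ (so $\tilde d=G\mathbf 1_{[0,\infty)}$), $\lambda=(I-\delta(0)G)^{-1}\mathbf 1_{[0,\infty)}=\sum_{k\ge0}\delta(0)^kG^k\mathbf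 1_{[0,\infty)}$, and $\tilde\lambda=(I-\delta(0)G)^{-1}\tilde d$, that is, $\tilde\lambda=(\lambda-\mathbf 1_{[0,\infty)})/\delta(0)$ if $\delta(0)\ne0$ and $\tilde\lambda=\tilde d$ if $\delta(0)=0$. For $x\in(0,1]$ let $\tilde R^+(x)=[\max\{1,\frac{2x}c-1\},1+\frac{2x}c]$, $\tilde R^-(x)=[-1,\min\{1,\frac{2x}c-1\}]$, and for $f\in\{\lambda,\tilde\lambda\}$ let $$\Delta_f(x)=\min\{1,\tfrac xc\}\Big(\tfrac1{|\tilde R^+(x)|}\int_{\tilde R^+(x)}f-\tfrac1{|\tilde R^-(x)|}\int_{\tilde R^-(x)}f\Big).$$ Then, for $p=0,1$, $\Lambda^+_p=\int_0^1x^p\Delta_\lambda(x)K(x)\,dx$, $\Lambda^-_p=-\int_{-1}^0x^p\Delta_\lambda(-x)K(x)\,dx$, $\tilde\Lambda^\pm_p$ are the same with $\Delta_{\tilde\lambda}$ in place of $\Delta_\lambda$, and $\Gamma^+_p=\int_0^1x^p\tilde d(\tfrac{2x}c)K(x)\,dx$, $\Gamma^-_p=\int_{-1}^0x^p\tilde d(\tfrac{2x}c)K(x)\,dx$.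 -/

import Mathlib

open MeasureTheory ProbabilityTheory Filter Set
open scoped Topology ENNReal NNReal

noncomputable section

namespace RDSpillover

/-! ### Population: agents, neighbourhoods, potential outcomes -/

/-- The space of agents (values of the running variable). -/
def agents : Set ℝ := Icc (-1) 1

/-- The distribution of the agents: uniform on `[-1, 1]`, i.e. density `1 / 2`. -/
def agentLaw : Measure ℝ := (2⁻¹ : ℝ≥0∞) • (volume.restrict agents)

/-- The neighbourhood of `z` for the spillover radius `r`: all agents at distance less than `r`. -/
def nbhd (r z : ℝ) : Set ℝ := {u | u ∈ agents ∧ |z - u| < r}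

/-- The mean of `f` over the neighbours of `z`. -/
def nbhdMean (r : ℝ) (f : ℝ → ℝ) (z : ℝ) : ℝ :=
  (agentLaw.real (nbhd r z))⁻¹ * ∫ u in nbhd r z, f u ∂agentLaw

/-- The functions of the linear-in-means model. Only their values on `[-1, 1]` matter. -/
structure Model where
  /-- structural outcome function under treatment -/
  mPlus : ℝ → ℝ
  /-- structural outcome function under control -/
  mMinus : ℝ → ℝ
  /-- strength of the endogenous spillover -/
  delta : ℝ → ℝ
  /-- strength of the exogenous spillover -/
  gamma : ℝ → ℝ

/-- The regularity conditions on the functions of the model. -/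
structure Model.Regular (M : Model) (C : ℝ≥0) (Cδ Cγ δbar : ℝ) : Prop where
  mPlus_lipschitz : LipschitzOnWith C M.mPlus agents
  mMinus_lipschitz : LipschitzOnWith C M.mMinus agents
  delta_contDiff : ContDiffOn ℝ 1 M.delta agents
  delta_deriv : ∀ z ∈ agents, |derivWithin M.delta agents z| < Cδ
  delta_le : ∀ z ∈ agents, |M.delta z| ≤ δbar
  delta_osc : ∀ z₁ ∈ agents, ∀ z₂ ∈ agents, |M.delta z₁ - M.delta z₂| ≤ δbar
  δbar_lt_one : δbar < 1
  gamma_contDiff : ContDiffOn ℝ 1 M.gamma agents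
  gamma_deriv : ∀ z ∈ agents, |derivWithin M.gamma agents z| < Cγ

/-- Potential outcome under treatment of agent `z`, when the treatment assignment is `d` and the
realized outcomes are `Y`. -/
def Model.YPlus (M : Model) (r : ℝ) (d Y : ℝ → ℝ) (z : ℝ) : ℝ :=
  M.mPlus z + M.delta z * nbhdMean r Y z + M.gamma z * nbhdMean r d z

/-- Potential outcome under control of agent `z`, when the treatment assignment is `d` and the
realized outcomes are `Y`. -/
def Model.YMinus (M : Model) (r : ℝ) (d Y : ℝ → ℝ) (z : ℝ) : ℝ :=
  M.mMinus z + M.delta z * nbhdMean r Y z + M.gamma z * nbhdMean r d z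

/-- `Y` is the observed outcome function generated by the treatment assignment `d`: it solves the
simultaneous equations of the model on `[-1, 1]`. -/
structure Model.IsOutcome (M : Model) (r : ℝ) (d Y : ℝ → ℝ) : Prop where
  integrable : Integrable Y agentLaw
  eq : ∀ z ∈ agents, Y z = d z * M.YPlus r d Y z + (1 - d z) * M.YMinus r d Y z

/-- The indicator of `[0, ∞)`; this is the treatment assignment of the discontinuity design. -/
def treat : ℝ → ℝ := (Ici (0 : ℝ)).indicator fun _ => 1

/-- The assignment that treats everyone. -/
def treatAll : ℝ → ℝ := fun _ => 1

/-- The assignment that treats no one. -/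
def treatNone : ℝ → ℝ := fun _ => 0

/-- The direct treatment effect at the cut-off. -/
def Model.directEffect (M : Model) : ℝ := M.mPlus 0 - M.mMinus 0

/-- The direct effect is the difference of the two potential outcomes at the cut-off under the
same treatment assignment. -/
theorem Model.directEffect_eq (M : Model) (r : ℝ) (d Y : ℝ → ℝ) :
    M.YPlus r d Y 0 - M.YMinus r d Y 0 = M.directEffect := by
  unfold Model.YPlus Model.YMinus Model.directEffect
  ring

/-- The total treatment effect at the cut-off; `Yall` and `Ynone` are the outcome functions when
everyone, respectively no one, is treated. -/
def Model.totalEffect (M : Model) (r : ℝ) (Yall Ynone : ℝ → ℝ) : ℝ :=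
  M.YPlus r treatAll Yall 0 - M.YMinus r treatNone Ynone 0

/-! ### Sampling and the local linear estimator -/

/-- `(Y i, Z i)`, `i < n`, is an i.i.d. sample with `Z i` uniform on `[-1, 1]`,
`Y i = Yd (Z i) + ε i`, `E[ε i | Z i] = 0` and `E[(ε i)² | Z i] ≤ σ²`. -/
structure IsSample {Ω : Type*} [MeasurableSpace Ω] (P : Measure Ω) (Yd : ℝ → ℝ) (σ : ℝ) {n : ℕ}
    (Y Z ε : Fin n → Ω → ℝ) : Prop where
  measurable_Y : ∀ i, Measurable (Y i)
  measurable_Z : ∀ i, Measurable (Z i)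
  indep : iIndepFun (fun i ω => (Y i ω, Z i ω)) P
  identDistrib : ∀ i j, IdentDistrib (fun ω => (Y i ω, Z i ω)) (fun ω => (Y j ω, Z j ω)) P P
  law_Z : ∀ i, P.map (Z i) = agentLaw
  outcome : ∀ i ω, Y i ω = Yd (Z i ω) + ε i ω
  memLp_noise : ∀ i, MemLp (ε i) 2 P
  noise_mean : ∀ i, P[ε i | MeasurableSpace.comap (Z i) inferInstance] =ᵐ[P] 0
  noise_var : ∀ i, P[fun ω => ε i ω ^ 2 | MeasurableSpace.comap (Z i) inferInstance]
    ≤ᵐ[P] fun _ => σ ^ 2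

/-- A bounded non-negative second-order kernel supported in `[-1, 1]`. -/
structure IsKernel (K : ℝ → ℝ) (Kbar : ℝ) : Prop where
  measurable : Measurable K
  nonneg : ∀ u, 0 ≤ K u
  le : ∀ u, K u ≤ Kbar
  support : ∀ u, u < -1 ∨ 1 < u → K u = 0
  integral_one : ∫ u in (-1 : ℝ)..1, K u = 1
  integral_id : ∫ u in (-1 : ℝ)..1, u * K u = 0

/-- The local linear least-squares criterion over the treated observations, `Z i ≥ 0`. -/
def critPlus (K : ℝ → ℝ) (h : ℝ) {n : ℕ} (y z : Fin n → ℝ) (b : ℝ × ℝ) : ℝ :=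
  ∑ i with 0 ≤ z i, K (z i / h) * (y i - b.1 - b.2 * z i) ^ 2

/-- The local linear least-squares criterion over the control observations, `Z i < 0`. -/
def critMinus (K : ℝ → ℝ) (h : ℝ) {n : ℕ} (y z : Fin n → ℝ) (b : ℝ × ℝ) : ℝ :=
  ∑ i with z i < 0, K (z i / h) * (y i - b.1 - b.2 * z i) ^ 2

/-- `τ` is a value of the local linear discontinuity estimator on the data `(y, z)`: the difference
of the intercepts of a minimizer on the treated and a minimizer on the control side. -/
def IsRDDEstimate (K : ℝ → ℝ) (h : ℝ) {n : ℕ} (y z : Fin n → ℝ) (τ : ℝ) : Prop :=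
  ∃ bp bm : ℝ × ℝ, IsMinOn (critPlus K h y z) univ bp ∧ IsMinOn (critMinus K h y z) univ bm ∧
    τ = bp.1 - bm.1

/-! ### The limit when radius and bandwidth are of the same order -/

/-- The averaging operator on functions on the line with radius one. -/
def smooth (f : ℝ → ℝ) (a : ℝ) : ℝ := (1 / 2) * ∫ u in (a - 1)..(a + 1), f u

/-- `d̃`: the share of treated neighbours of the point at (signed) distance `a` radii from the
cut-off. It is `smooth treat`. -/
def dTilde (a : ℝ) : ℝ := max 0 (min 1 ((a + 1) / 2))

/-- `λ = (I - δ₀ G)⁻¹ 1{· ≥ 0}`, by its Neumann series, where `G` is the averaging operator. -/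
def lam (δ₀ : ℝ) (a : ℝ) : ℝ := ∑' k : ℕ, δ₀ ^ k * (smooth^[k] treat) a

/-- `λ̃ = (I - δ₀ G)⁻¹ d̃`, which is `(λ - 1{· ≥ 0}) / δ₀` if `δ₀ ≠ 0` and `d̃` if `δ₀ = 0`. -/
def lamTilde (δ₀ : ℝ) (a : ℝ) : ℝ :=
  if δ₀ = 0 then dTilde a else (lam δ₀ a - treat a) / δ₀

/-- The neighbours of `x` that are not neighbours of `0` (rescaled), for `x ≥ 0`. -/
def RPlus (c x : ℝ) : Set ℝ := Icc (max 1 (2 * x / c - 1)) (1 + 2 * x / c)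

/-- The neighbours of `0` that are not neighbours of `x` (rescaled), for `x ≥ 0`. -/
def RMinus (c x : ℝ) : Set ℝ := Icc (-1) (min 1 (2 * x / c - 1))

/-- The mean of `f` over `RPlus` minus its mean over `RMinus`, weighted by the share of
non-common neighbours, for `x ≥ 0`. -/
def contrast (c : ℝ) (f : ℝ → ℝ) (x : ℝ) : ℝ :=
  min 1 (x / c) * ((⨍ a in RPlus c x, f a) - ⨍ a in RMinus c x, f a)

/-- Kernel moments on the treated side. -/
def momPlus (K : ℝ → ℝ) (p : ℕ) : ℝ := ∫ x in (0 : ℝ)..1, x ^ p * K x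

/-- Kernel moments on the control side. -/
def momMinus (K : ℝ → ℝ) (p : ℕ) : ℝ := ∫ x in (-1 : ℝ)..0, x ^ p * K x

/-- `Λ⁺_p` (for `f = λ`) and `Λ̃⁺_p` (for `f = λ̃`). -/
def LamPlus (K : ℝ → ℝ) (c : ℝ) (f : ℝ → ℝ) (p : ℕ) : ℝ :=
  ∫ x in (0 : ℝ)..1, x ^ p * contrast c f x * K x

/-- `Λ⁻_p` (for `f = λ`) and `Λ̃⁻_p` (for `f = λ̃`). -/
def LamMinus (K : ℝ → ℝ) (c : ℝ) (f : ℝ → ℝ) (p : ℕ) : ℝ :=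
  ∫ x in (-1 : ℝ)..0, x ^ p * (-contrast c f (-x)) * K x

/-- `Γ⁺_p`. -/
def GamPlus (K : ℝ → ℝ) (c : ℝ) (p : ℕ) : ℝ :=
  ∫ x in (0 : ℝ)..1, x ^ p * dTilde (2 * x / c) * K x

/-- `Γ⁻_p`. -/
def GamMinus (K : ℝ → ℝ) (c : ℝ) (p : ℕ) : ℝ :=
  ∫ x in (-1 : ℝ)..0, x ^ p * dTilde (2 * x / c) * K x

/-- The intercept of the kernel-weighted linear fit on the treated side, of a function whose
weighted moments of order `0` and `1` are `I 0` and `I 1`. -/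
def fitPlus (K : ℝ → ℝ) (I : ℕ → ℝ) : ℝ :=
  (momPlus K 2 * I 0 - momPlus K 1 * I 1) / (momPlus K 2 * momPlus K 0 - momPlus K 1 ^ 2)

/-- The intercept of the kernel-weighted linear fit on the control side. -/
def fitMinus (K : ℝ → ℝ) (I : ℕ → ℝ) : ℝ :=
  (momMinus K 2 * I 0 - momMinus K 1 * I 1) / (momMinus K 2 * momMinus K 0 - momMinus K 1 ^ 2)

/-- `τ_*`, for `τ_d = τd`, `δ(0) = δ₀`, `γ(0) = γ₀` and `c = lim 2 r_n / h_n`. -/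
def tauStar (K : ℝ → ℝ) (c τd δ₀ γ₀ : ℝ) : ℝ :=
  τd
    + δ₀ * τd * (fitPlus K (LamPlus K c (lam δ₀)) - fitMinus K (LamMinus K c (lam δ₀)))
    + δ₀ * γ₀ * (fitPlus K (LamPlus K c (lamTilde δ₀)) - fitMinus K (LamMinus K c (lamTilde δ₀)))
    + γ₀ * (fitPlus K (GamPlus K c) - fitMinus K (GamMinus K c))

end RDSpillover

end

open RDSpillover

/-! Each side of the estimator is the intercept of a weighted least-squares fit over a window of
width `h`. The normal equations express it through five kernel-weighted sample moments, and since `n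
h → ∞`, Chebyshev's inequality replaces these by their means
(`IsWeight.tendstoInMeasure_intercept`). After the substitution `z = h x`, dominated convergence
reduces the problem to the pointwise limit of `Yd n (h n * x) - a n`. The centring `a n` cancels
between the two intercepts, so only differences of outcomes near the cut-off matter
(`rdd_tendstoInMeasure`).

What remains is deterministic. If `r` is much larger than `h`, the agents at `h x` and at `0` have
almost the same neighbours; the spillovers are a common level and only the direct effect jumps
(`Model.Regular.tendsto_outcome_of_large_radius`).

If `r → 0`, measure distance in radii and freeze the coefficients at `0`. The model becomes an
equation on the whole line with the averaging operator `smooth`, and the Neumann series solves it: a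
constant plus multiples of `lam` and `lamTilde` (`Model.isLocalOutcome_treat`). As `|δ(0)| < 1`,
whatever happens `k` radii away is damped by `|δ(0)| ^ k`. Hence the outcome at `z` is uniformly
close to the limiting solution at `z / r` on every shrinking interval, whatever its size relative to
`r` (`Model.Regular.outcome_approx`). At `z = h x` the argument is `h x / r`. For `r / h → 0` it
runs to `±∞`, where `lamTilde` tends to `1 / (1 - δ(0))` or `0`, and the total effect appears. For
`r / h → κ` it tends to `x / κ`, and `smooth_lam`, `lamTilde_eq` and `contrast_eq` convert the limit
into the moments of `tauStar`. -/

namespace RDSpillover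

/-! ### Neighbourhoods and neighbourhood means -/

/-- The left end of the neighbourhood of `z`. -/
noncomputable def nbhdLo (r z : ℝ) : ℝ := max (-1) (z - r)

/-- The right end of the neighbourhood of `z`. -/
noncomputable def nbhdHi (r z : ℝ) : ℝ := min 1 (z + r)

lemma nbhdLo_add_le_nbhdHi {r z : ℝ} (hr : 0 < r) (hz : z ∈ agents) :
    nbhdLo r z + min r 1 ≤ nbhdHi r z := by
  obtain ⟨h1, h2⟩ := hz
  have := min_le_left r 1
  have := min_le_right r 1
  unfold nbhdLo nbhdHi
  rcases max_choice (-1) (z - r) with h | h <;> rw [h] <;> apply le_min <;> linarith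

lemma nbhdLo_lt_nbhdHi {r z : ℝ} (hr : 0 < r) (hz : z ∈ agents) : nbhdLo r z < nbhdHi r z := by
  have := nbhdLo_add_le_nbhdHi hr hz
  have : 0 < min r 1 := lt_min hr one_pos
  linarith

lemma Icc_nbhd_subset (r z : ℝ) : Icc (nbhdLo r z) (nbhdHi r z) ⊆ agents :=
  Icc_subset_Icc (le_max_left _ _) (min_le_left _ _)

lemma nbhd_ae_eq (r z : ℝ) : nbhd r z =ᵐ[volume] Ioc (nbhdLo r z) (nbhdHi r z) := by
  have : nbhd r z = Icc (-1) 1 ∩ Ioo (z - r) (z + r) := by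
    ext u
    simp only [nbhd, agents, mem_ofPred_eq, mem_inter_iff, mem_Icc, mem_Ioo, abs_lt]
    constructor <;> rintro ⟨⟨_, _⟩, _, _⟩ <;> refine ⟨⟨?_, ?_⟩, ?_, ?_⟩ <;> linarith
  rw [this, nbhdLo, nbhdHi, ← Ioc_inter_Ioc]
  exact Ioc_ae_eq_Icc.symm.inter Ioo_ae_eq_Ioc

lemma nbhd_subset (r z : ℝ) : nbhd r z ⊆ agents := fun _ hu => hu.1

lemma measurableSet_nbhd (r z : ℝ) : MeasurableSet (nbhd r z) := by
  have : nbhd r z = Icc (-1) 1 ∩ (fun u => |z - u|) ⁻¹' Iio r := rfl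
  rw [this]
  exact measurableSet_Icc.inter (measurableSet_Iio.preimage (by fun_prop))

lemma agentLaw_restrict_nbhd (r z : ℝ) :
    agentLaw.restrict (nbhd r z) =
      (2⁻¹ : ℝ≥0∞) • volume.restrict (Ioc (nbhdLo r z) (nbhdHi r z)) := by
  rw [agentLaw, Measure.restrict_smul, Measure.restrict_restrict (measurableSet_nbhd r z),
    inter_eq_left.2 (nbhd_subset r z), Measure.restrict_congr_set (nbhd_ae_eq r z)]

lemma nbhdMean_eq {r z : ℝ} (hr : 0 < r) (hz : z ∈ agents) (f : ℝ → ℝ) :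
    nbhdMean r f z = (nbhdHi r z - nbhdLo r z)⁻¹ * ∫ u in (nbhdLo r z)..(nbhdHi r z), f u := by
  have h := nbhdLo_lt_nbhdHi hr hz
  have h1 : agentLaw.real (nbhd r z) = 2⁻¹ * (nbhdHi r z - nbhdLo r z) := by
    rw [← measureReal_restrict_apply_univ, agentLaw_restrict_nbhd]
    simp [Measure.real, h.le]
  rw [nbhdMean, h1, agentLaw_restrict_nbhd, integral_smul_measure,
    intervalIntegral.integral_of_le h.le]
  simp only [ENNReal.toReal_inv, ENNReal.toReal_ofNat, smul_eq_mul, mul_inv, inv_inv]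
  ring

lemma nbhdMean_eq_of_interior {r z : ℝ} (hr : 0 < r) (hz : |z| + r ≤ 1) (f : ℝ → ℝ) :
    nbhdMean r f z = (2 * r)⁻¹ * ∫ u in (z - r)..(z + r), f u := by
  have := abs_le.1 (le_refl |z|)
  have h1 : nbhdLo r z = z - r := max_eq_right (by linarith)
  have h2 : nbhdHi r z = z + r := min_eq_right (by linarith)
  rw [nbhdMean_eq hr ⟨by linarith, by linarith⟩, h1, h2]
  congr 2
  ring

lemma integrable_agentLaw_iff {f : ℝ → ℝ} : Integrable f agentLaw ↔ IntegrableOn f agents := by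
  rw [agentLaw, integrable_smul_measure (by simp) (by simp), IntegrableOn]

lemma intervalIntegrable_of_agentLaw {f : ℝ → ℝ} (hf : Integrable f agentLaw) {a b : ℝ}
    (ha : a ∈ agents) (hb : b ∈ agents) : IntervalIntegrable f volume a b :=
  ((integrable_agentLaw_iff.1 hf).mono_set (ordConnected_Icc.uIcc_subset ha hb)).intervalIntegrable

lemma nbhdLo_mem {r z : ℝ} (hr : 0 < r) (hz : z ∈ agents) : nbhdLo r z ∈ agents :=
  Icc_nbhd_subset r z (left_mem_Icc.2 (nbhdLo_lt_nbhdHi hr hz).le)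

lemma nbhdHi_mem {r z : ℝ} (hr : 0 < r) (hz : z ∈ agents) : nbhdHi r z ∈ agents :=
  Icc_nbhd_subset r z (right_mem_Icc.2 (nbhdLo_lt_nbhdHi hr hz).le)

lemma abs_integral_le_of_agents {f : ℝ → ℝ} {B : ℝ} (hB : ∀ u ∈ agents, |f u| ≤ B) {a b : ℝ}
    (ha : a ∈ agents) (hb : b ∈ agents) : |∫ u in a..b, f u| ≤ B * |b - a| := by
  refine intervalIntegral.norm_integral_le_of_norm_le_const (f := f) fun u hu => hB u ?_
  exact ordConnected_Icc.uIcc_subset ha hb (uIoc_subset_uIcc hu)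

lemma abs_nbhdMean_le {r z B : ℝ} {f : ℝ → ℝ} (hr : 0 < r) (hz : z ∈ agents)
    (hB : ∀ u ∈ agents, |f u| ≤ B) : |nbhdMean r f z| ≤ B := by
  have h := sub_pos.2 (nbhdLo_lt_nbhdHi hr hz)
  rw [nbhdMean_eq hr hz, abs_mul, abs_of_pos (inv_pos.2 h), inv_mul_le_iff₀ h]
  have := abs_integral_le_of_agents hB (nbhdLo_mem hr hz) (nbhdHi_mem hr hz)
  rw [abs_of_pos h] at this
  linarith

lemma zero_mem_agents : (0 : ℝ) ∈ agents := by constructor <;> norm_num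

/-- Both ends of the window move by at most `|z|`. This changes the integral by at most `2 * B *
|z|` and the length by at most `2 * |z|`, while the window at `0` has length at least `min r 1`. The
minimum covers radii larger than the population. -/
lemma abs_nbhdMean_sub_le {r z B : ℝ} {f : ℝ → ℝ} (hr : 0 < r) (hz : z ∈ agents)
    (hf : Integrable f agentLaw) (hB : ∀ u ∈ agents, |f u| ≤ B) :
    |nbhdMean r f z - nbhdMean r f 0| ≤ 4 * B * (|z| / min r 1) := by
  have hm : 0 < min r 1 := lt_min hr one_pos
  have B0 : 0 ≤ B := (abs_nonneg _).trans (hB 0 zero_mem_agents)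
  have hl := nbhdLo_add_le_nbhdHi hr zero_mem_agents
  have h0 : 0 < nbhdHi r 0 - nbhdLo r 0 := by linarith
  have hbd := abs_nbhdMean_le hr hz hB
  have hlip1 : |nbhdHi r z - nbhdHi r 0| ≤ |z| := by
    have := abs_min_sub_min_le_max (1 : ℝ) (z + r) 1 (0 + r)
    simpa [nbhdHi] using this
  have hlip2 : |nbhdLo r z - nbhdLo r 0| ≤ |z| := by
    have := abs_max_sub_max_le_max (-1 : ℝ) (z - r) (-1) (0 - r)
    simpa [nbhdLo] using this
  have e1 : (nbhdHi r z - nbhdLo r z) * nbhdMean r f z = ∫ u in (nbhdLo r z)..(nbhdHi r z), f u := by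
    rw [nbhdMean_eq hr hz, mul_inv_cancel_left₀ (sub_pos.2 (nbhdLo_lt_nbhdHi hr hz)).ne']
  have e0 : (nbhdHi r 0 - nbhdLo r 0) * nbhdMean r f 0 = ∫ u in (nbhdLo r 0)..(nbhdHi r 0), f u := by
    rw [nbhdMean_eq hr zero_mem_agents, mul_inv_cancel_left₀ h0.ne']
  have hi := nbhdHi_mem hr hz
  have lo := nbhdLo_mem hr hz
  have hi0 := nbhdHi_mem hr zero_mem_agents
  have lo0 := nbhdLo_mem hr zero_mem_agents
  have e2 := intervalIntegral.integral_interval_sub_interval_comm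
    (intervalIntegrable_of_agentLaw hf lo hi) (intervalIntegrable_of_agentLaw hf lo0 hi0)
    (intervalIntegrable_of_agentLaw hf lo lo0)
  have b1 := abs_integral_le_of_agents hB lo lo0
  have b2 := abs_integral_le_of_agents hB hi hi0
  rw [abs_sub_comm] at b1 b2
  have key : (nbhdHi r 0 - nbhdLo r 0) * (nbhdMean r f z - nbhdMean r f 0) =
      ((∫ u in (nbhdLo r z)..(nbhdLo r 0), f u) - ∫ u in (nbhdHi r z)..(nbhdHi r 0), f u)
        - ((nbhdHi r z - nbhdHi r 0) - (nbhdLo r z - nbhdLo r 0)) * nbhdMean r f z := by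
    rw [← e2, ← e1, ← e0]; ring
  have k2 : (nbhdHi r 0 - nbhdLo r 0) * |nbhdMean r f z - nbhdMean r f 0| ≤ 4 * B * |z| := by
    rw [← abs_of_pos h0, ← abs_mul, key]
    refine (abs_sub _ _).trans ?_
    have c1 := (abs_sub (∫ u in (nbhdLo r z)..(nbhdLo r 0), f u)
      (∫ u in (nbhdHi r z)..(nbhdHi r 0), f u))
    have c2 := abs_sub (nbhdHi r z - nbhdHi r 0) (nbhdLo r z - nbhdLo r 0)
    have c3 : B * |nbhdLo r z - nbhdLo r 0| ≤ B * |z| := by gcongr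
    have c4 : B * |nbhdHi r z - nbhdHi r 0| ≤ B * |z| := by gcongr
    rw [abs_mul]
    have c5 : |nbhdHi r z - nbhdHi r 0 - (nbhdLo r z - nbhdLo r 0)| * |nbhdMean r f z|
        ≤ (2 * |z|) * B := by
      gcongr
      linarith
    linarith
  rw [← mul_div_assoc, le_div_iff₀ hm]
  refine le_trans ?_ k2
  rw [mul_comm]
  gcongr
  linarith

/-! ### A priori bounds on outcomes -/

lemma continuousOn_agents_bdd {f : ℝ → ℝ} (hf : ContinuousOn f agents) :
    ∃ B, 0 ≤ B ∧ ∀ z ∈ agents, |f z| ≤ B := by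
  obtain ⟨B, hB⟩ := isCompact_Icc.exists_bound_of_continuousOn hf
  exact ⟨B, (norm_nonneg _).trans (hB 0 zero_mem_agents), hB⟩

lemma Model.IsOutcome.eq' {M : Model} {r : ℝ} {d Y : ℝ → ℝ} (hY : M.IsOutcome r d Y)
    {z : ℝ} (hz : z ∈ agents) :
    Y z = (d z * M.mPlus z + (1 - d z) * M.mMinus z) + M.delta z * nbhdMean r Y z
      + M.gamma z * nbhdMean r d z := by
  rw [hY.eq z hz, Model.YPlus, Model.YMinus]; ring

/-- The equation gives `S ≤ Bp + Bm + Bg + q * S` for the supremum `S` of `|Y|`, and `q < 1` lets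
the last term be absorbed. The resulting bound does not depend on the radius. -/
lemma Model.IsOutcome.bounded {M : Model} {r : ℝ} {d Y : ℝ → ℝ} (hr : 0 < r)
    (hY : M.IsOutcome r d Y) {q Bp Bm Bg : ℝ} (hq : q < 1) (hδ : ∀ z ∈ agents, |M.delta z| ≤ q)
    (hp : ∀ z ∈ agents, |M.mPlus z| ≤ Bp) (hm : ∀ z ∈ agents, |M.mMinus z| ≤ Bm)
    (hg : ∀ z ∈ agents, |M.gamma z| ≤ Bg) (hd0 : ∀ z, 0 ≤ d z) (hd1 : ∀ z, d z ≤ 1) :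
    ∀ z ∈ agents, |Y z| ≤ (Bp + Bm + Bg) / (1 - q) := by
  have q0 : 0 ≤ q := (abs_nonneg _).trans (hδ 0 zero_mem_agents)
  have step : ∀ S z, z ∈ agents → |nbhdMean r Y z| ≤ S → |Y z| ≤ Bp + Bm + Bg + q * S := by
    intro S z hz hS
    have hdm : |nbhdMean r d z| ≤ 1 := abs_nbhdMean_le hr hz fun u _ => abs_le.2
      ⟨by linarith [hd0 u], hd1 u⟩
    have h1 : |d z * M.mPlus z| ≤ 1 * Bp := by
      rw [abs_mul, abs_of_nonneg (hd0 z)]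
      exact mul_le_mul (hd1 z) (hp z hz) (abs_nonneg _) zero_le_one
    have h2 : |(1 - d z) * M.mMinus z| ≤ 1 * Bm := by
      rw [abs_mul, abs_of_nonneg (by linarith [hd1 z])]
      exact mul_le_mul (by linarith [hd0 z]) (hm z hz) (abs_nonneg _) zero_le_one
    have h3 : |M.delta z * nbhdMean r Y z| ≤ q * S := by
      rw [abs_mul]; exact mul_le_mul (hδ z hz) hS (abs_nonneg _) q0
    have h4 : |M.gamma z * nbhdMean r d z| ≤ Bg * 1 := by
      rw [abs_mul]
      exact mul_le_mul (hg z hz) hdm (abs_nonneg _) ((abs_nonneg _).trans (hg z hz))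
    rw [hY.eq' hz]
    have a1 := abs_add_le (d z * M.mPlus z + (1 - d z) * M.mMinus z + M.delta z * nbhdMean r Y z)
      (M.gamma z * nbhdMean r d z)
    have a2 := abs_add_le (d z * M.mPlus z + (1 - d z) * M.mMinus z) (M.delta z * nbhdMean r Y z)
    have a3 := abs_add_le (d z * M.mPlus z) ((1 - d z) * M.mMinus z)
    linarith
  -- Absorption requires a finite supremum. Integrability bounds the neighbourhood means, with a
  -- constant depending on `r`, and the equation then bounds `Y` itself.
  have crude : ∃ S, ∀ z ∈ agents, |nbhdMean r Y z| ≤ S := by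
    refine ⟨(min r 1)⁻¹ * ∫ u in agents, |Y u|, fun z hz => ?_⟩
    have h := nbhdLo_lt_nbhdHi hr hz
    have hm : 0 < min r 1 := lt_min hr one_pos
    rw [nbhdMean_eq hr hz, abs_mul, abs_of_pos (inv_pos.2 (sub_pos.2 h))]
    refine mul_le_mul ?_ ?_ (abs_nonneg _) (inv_pos.2 hm).le
    · exact inv_anti₀ hm (by linarith [nbhdLo_add_le_nbhdHi hr hz])
    · rw [intervalIntegral.integral_of_le h.le]
      refine (abs_integral_le_integral_abs).trans ?_
      exact setIntegral_mono_set (integrable_agentLaw_iff.1 hY.integrable).abs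
        (Eventually.of_forall fun _ => abs_nonneg _)
        (Ioc_subset_Icc_self.trans (Icc_nbhd_subset r z)).eventuallyLE
  obtain ⟨S, hS⟩ := crude
  have bdd : BddAbove (range fun z : agents => |Y z|) := by
    refine ⟨Bp + Bm + Bg + q * S, ?_⟩
    rintro _ ⟨z, rfl⟩
    exact step S z z.2 (hS z z.2)
  have : Nonempty agents := ⟨⟨0, zero_mem_agents⟩⟩
  have hsup : ⨆ z : agents, |Y z| ≤ Bp + Bm + Bg + q * ⨆ z : agents, |Y z| := by
    refine ciSup_le fun z => step _ z z.2 (abs_nbhdMean_le hr z.2 fun u hu => ?_)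
    exact le_ciSup bdd (⟨u, hu⟩ : agents)
  intro z hz
  rw [le_div_iff₀ (by linarith)]
  have h1 := le_ciSup bdd (⟨z, hz⟩ : agents)
  simp only at h1
  nlinarith

lemma Model.Regular.outcome_bounded {M : Model} {C : ℝ≥0} {Cδ Cγ δbar : ℝ}
    (hM : M.Regular C Cδ Cγ δbar) :
    ∃ B, 0 ≤ B ∧ ∀ (r : ℝ) (d Y : ℝ → ℝ), 0 < r → (∀ z, 0 ≤ d z) → (∀ z, d z ≤ 1) →
      M.IsOutcome r d Y → ∀ z ∈ agents, |Y z| ≤ B := by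
  obtain ⟨Bp, Bp0, hp⟩ := continuousOn_agents_bdd hM.mPlus_lipschitz.continuousOn
  obtain ⟨Bm, Bm0, hm⟩ := continuousOn_agents_bdd hM.mMinus_lipschitz.continuousOn
  obtain ⟨Bg, Bg0, hg⟩ := continuousOn_agents_bdd hM.gamma_contDiff.continuousOn
  have := hM.δbar_lt_one
  refine ⟨(Bp + Bm + Bg) / (1 - δbar), by have : 0 < 1 - δbar := by linarith
                                          positivity, ?_⟩
  intro r d Y hr hd0 hd1 hY
  exact hY.bounded hr hM.δbar_lt_one hM.delta_le hp hm hg hd0 hd1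

/-! ### The averaging operator and the Neumann series -/

lemma treat_nonneg (z : ℝ) : 0 ≤ treat z := indicator_nonneg (fun _ _ => zero_le_one) z

lemma treat_le_one (z : ℝ) : treat z ≤ 1 := by
  unfold treat indicator; split_ifs <;> norm_num

lemma treat_of_nonneg {z : ℝ} (hz : 0 ≤ z) : treat z = 1 := indicator_of_mem hz _

lemma treat_of_neg {z : ℝ} (hz : z < 0) : treat z = 0 := indicator_of_notMem (by simpa using hz) _

lemma measurable_treat : Measurable treat := measurable_const.indicator measurableSet_Ici

/-- Bounded measurable functions on the line. -/
def BddMeas (f : ℝ → ℝ) : Prop := Measurable f ∧ ∃ B, ∀ a, |f a| ≤ B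

lemma BddMeas.integrableOn {f : ℝ → ℝ} (hf : BddMeas f) {s : Set ℝ} (hs : volume s ≠ ∞) :
    IntegrableOn f s := by
  obtain ⟨hm, B, hB⟩ := hf
  have : IsFiniteMeasure (volume.restrict s) := ⟨by
    rw [Measure.restrict_apply_univ]; exact hs.lt_top⟩
  exact Integrable.of_bound hm.aestronglyMeasurable B (Eventually.of_forall hB)

lemma BddMeas.intervalIntegrable {f : ℝ → ℝ} (hf : BddMeas f) (a b : ℝ) :
    IntervalIntegrable f volume a b :=
  (hf.integrableOn (by simp [uIcc])).intervalIntegrable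

lemma BddMeas.const (C : ℝ) : BddMeas fun _ => C := ⟨measurable_const, |C|, fun _ => le_rfl⟩

lemma BddMeas.add {f g : ℝ → ℝ} (hf : BddMeas f) (hg : BddMeas g) :
    BddMeas fun a => f a + g a := by
  obtain ⟨hf, B, hB⟩ := hf
  obtain ⟨hg, D, hD⟩ := hg
  exact ⟨hf.add hg, B + D, fun a => (abs_add_le _ _).trans (add_le_add (hB a) (hD a))⟩

lemma BddMeas.const_mul {f : ℝ → ℝ} (hf : BddMeas f) (C : ℝ) : BddMeas fun a => C * f a := by
  obtain ⟨hf, B, hB⟩ := hf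
  exact ⟨hf.const_mul C, |C| * B, fun a => by rw [abs_mul]; gcongr; exact hB a⟩

lemma bddMeas_treat : BddMeas treat :=
  ⟨measurable_treat, 1, fun a => abs_le.2 ⟨by linarith [treat_nonneg a], treat_le_one a⟩⟩

lemma BddMeas.continuous_smooth {f : ℝ → ℝ} (hf : BddMeas f) : Continuous (smooth f) := by
  have h : smooth f = fun a => (1 / 2) * ((∫ u in (0 : ℝ)..(a + 1), f u)
      - ∫ u in (0 : ℝ)..(a - 1), f u) := by
    ext a
    rw [smooth, intervalIntegral.integral_interval_sub_left] <;> exact hf.intervalIntegrable _ _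
  have hp := intervalIntegral.continuous_primitive (μ := volume) hf.intervalIntegrable 0
  rw [h]
  fun_prop

lemma abs_smooth_le {f : ℝ → ℝ} {B : ℝ} (hB : ∀ a, |f a| ≤ B) (a : ℝ) : |smooth f a| ≤ B := by
  have := intervalIntegral.norm_integral_le_of_norm_le_const (f := f) (a := a - 1) (b := a + 1)
    fun u _ => hB u
  rw [smooth, abs_mul, abs_of_pos (by norm_num : (0 : ℝ) < 1 / 2)]
  rw [Real.norm_eq_abs, show a + 1 - (a - 1) = 2 by ring, abs_two] at this
  linarith

lemma BddMeas.smooth {f : ℝ → ℝ} (hf : BddMeas f) : BddMeas (smooth f) :=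
  ⟨hf.continuous_smooth.measurable, hf.2.choose, abs_smooth_le hf.2.choose_spec⟩

lemma smooth_const (C a : ℝ) : smooth (fun _ => C) a = C := by
  simp [RDSpillover.smooth]; ring

lemma smooth_add {f g : ℝ → ℝ} (hf : BddMeas f) (hg : BddMeas g) (a : ℝ) :
    smooth (fun u => f u + g u) a = smooth f a + smooth g a := by
  unfold RDSpillover.smooth
  rw [intervalIntegral.integral_add (hf.intervalIntegrable _ _) (hg.intervalIntegrable _ _)]
  ring

lemma smooth_const_mul (C : ℝ) (f : ℝ → ℝ) (a : ℝ) :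
    smooth (fun u => C * f u) a = C * smooth f a := by
  unfold RDSpillover.smooth
  rw [intervalIntegral.integral_const_mul]
  ring

lemma smooth_neg_of_symm {f : ℝ → ℝ} {C : ℝ} (hf : BddMeas f) (h : ∀ a, f (-a) = C - f a) (a : ℝ) :
    smooth f (-a) = C - smooth f a := by
  have h1 : smooth f (-a) = smooth (fun u => f (-u)) a := by
    unfold RDSpillover.smooth
    rw [intervalIntegral.integral_comp_neg]
    congr 2 <;> ring
  have h2 : (fun u => f (-u)) = fun u => C + (-1) * f u := by ext u; rw [h]; ring
  rw [h1, h2, smooth_add (BddMeas.const C) (hf.const_mul _), smooth_const, smooth_const_mul]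
  ring

lemma integral_treat (b : ℝ) : ∫ u in (0 : ℝ)..b, treat u = max 0 b := by
  rcases le_total 0 b with hb | hb
  · rw [max_eq_right hb, intervalIntegral.integral_congr (g := fun _ => (1 : ℝ))]
    · simp
    · intro u hu
      rw [uIcc_of_le hb] at hu
      exact treat_of_nonneg hu.1
  · rw [max_eq_left hb, intervalIntegral.integral_symm, intervalIntegral.integral_of_le hb,
      integral_Ioc_eq_integral_Ioo, setIntegral_congr_fun (g := fun _ => (0 : ℝ)) measurableSet_Ioo]
    · simp
    · intro u hu
      exact treat_of_neg hu.2

lemma smooth_treat : smooth treat = dTilde := by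
  ext a
  rw [smooth, ← intervalIntegral.integral_interval_sub_left (a := 0)
    (bddMeas_treat.intervalIntegrable _ _) (bddMeas_treat.intervalIntegrable _ _),
    integral_treat, integral_treat, dTilde]
  rcases le_total (a + 1) 0 with h1 | h1
  · rw [max_eq_left h1, max_eq_left (by linarith), min_eq_right (by linarith),
      max_eq_left (by linarith)]
    norm_num
  · rw [max_eq_right h1]
    rcases le_total (a - 1) 0 with h2 | h2
    · rw [max_eq_left h2, min_eq_right (by linarith), max_eq_right (by linarith)]
      ring
    · rw [max_eq_right h2, min_eq_left (by linarith), max_eq_right (by norm_num)]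
      ring

lemma dTilde_neg (a : ℝ) : dTilde (-a) = 1 - dTilde a := by
  unfold dTilde
  rcases le_total (a + 1) 0 with h1 | h1
  · rw [min_eq_left (by linarith), max_eq_right (by norm_num), min_eq_right (by linarith),
      max_eq_left (by linarith)]; norm_num
  · rcases le_total (a - 1) 0 with h2 | h2
    · rw [min_eq_right (by linarith), max_eq_right (by linarith), min_eq_right (by linarith),
        max_eq_right (by linarith)]; ring
    · rw [min_eq_right (by linarith), max_eq_left (by linarith), min_eq_left (by linarith),
        max_eq_right (by norm_num)]; ring

lemma bddMeas_iterate (k : ℕ) : BddMeas (smooth^[k] treat) := by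
  induction k with
  | zero => exact bddMeas_treat
  | succ k ih => rw [Function.iterate_succ_apply']; exact ih.smooth

lemma abs_iterate_le (k : ℕ) (a : ℝ) : |(smooth^[k] treat) a| ≤ 1 := by
  induction k generalizing a with
  | zero =>
    rw [Function.iterate_zero_apply]
    exact abs_le.2 ⟨by linarith [treat_nonneg a], treat_le_one a⟩
  | succ k ih => rw [Function.iterate_succ_apply']; exact abs_smooth_le ih a

lemma continuous_iterate (k : ℕ) : Continuous (smooth^[k + 1] treat) := by
  rw [Function.iterate_succ_apply']; exact (bddMeas_iterate k).continuous_smooth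

/-- Averaging preserves reflection symmetry. The index starts at one because `treat` itself violates
the symmetry at `0`. -/
lemma iterate_neg (k : ℕ) (a : ℝ) :
    (smooth^[k + 1] treat) (-a) = 1 - (smooth^[k + 1] treat) a := by
  induction k generalizing a with
  | zero => simp only [zero_add, Function.iterate_one, smooth_treat, dTilde_neg]
  | succ k ih =>
    rw [Function.iterate_succ_apply']
    exact smooth_neg_of_symm (bddMeas_iterate _) ih a

/-- Each averaging looks one radius further, so `k` of them do not see the control side from
distance `k`. -/
lemma iterate_eq_one (k : ℕ) {a : ℝ} (ha : (k : ℝ) ≤ a) : (smooth^[k] treat) a = 1 := by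
  induction k generalizing a with
  | zero => exact treat_of_nonneg (by simpa using ha)
  | succ k ih =>
    push_cast at ha
    rw [Function.iterate_succ_apply', smooth,
      intervalIntegral.integral_congr (g := fun _ => (1 : ℝ))]
    · simp; norm_num
    · intro u hu
      rw [uIcc_of_le (by linarith)] at hu
      exact ih (by linarith [hu.1])

lemma abs_term_le (δ : ℝ) (k j : ℕ) (a : ℝ) : |δ ^ k * (smooth^[j] treat) a| ≤ |δ| ^ k := by
  rw [abs_mul, abs_pow]
  exact mul_le_of_le_one_right (by positivity) (abs_iterate_le j a)

lemma summable_abs_pow {δ : ℝ} (hδ : |δ| < 1) : Summable fun k : ℕ => |δ| ^ k :=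
  summable_geometric_of_lt_one (abs_nonneg δ) hδ

lemma summable_term {δ : ℝ} (hδ : |δ| < 1) (i : ℕ) (a : ℝ) :
    Summable fun k => δ ^ k * (smooth^[k + i] treat) a :=
  Summable.of_norm_bounded (summable_abs_pow hδ) fun k => abs_term_le δ k (k + i) a

lemma lam_eq_tsum {δ : ℝ} (hδ : |δ| < 1) (a : ℝ) :
    lam δ a = treat a + δ * ∑' k, δ ^ k * (smooth^[k + 1] treat) a := by
  have h : Summable fun k => δ ^ k * (smooth^[k] treat) a := summable_term hδ 0 a
  rw [lam, h.tsum_eq_zero_add, ← tsum_mul_left]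
  simp only [pow_zero, Function.iterate_zero, id, one_mul]
  congr 2
  ext k
  rw [pow_succ]
  ring

/-- One series covers both cases of the definition: for `δ = 0` only the term `k = 0` survives. Its
terms are continuous, so the jump of `lam` is carried by `treat` alone. -/
lemma lamTilde_eq_tsum {δ : ℝ} (hδ : |δ| < 1) (a : ℝ) :
    lamTilde δ a = ∑' k, δ ^ k * (smooth^[k + 1] treat) a := by
  rw [lamTilde]
  split_ifs with h
  · subst h
    rw [tsum_eq_single 0]
    · simp [smooth_treat]
    · intro k hk; simp [hk]
  · rw [lam_eq_tsum hδ]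
    field_simp
    ring

lemma lam_eq {δ : ℝ} (hδ : |δ| < 1) (a : ℝ) : lam δ a = treat a + δ * lamTilde δ a := by
  rw [lam_eq_tsum hδ, lamTilde_eq_tsum hδ]

lemma continuous_lamTilde {δ : ℝ} (hδ : |δ| < 1) : Continuous (lamTilde δ) := by
  rw [show lamTilde δ = fun a => ∑' k, δ ^ k * (smooth^[k + 1] treat) a from
    funext (lamTilde_eq_tsum hδ)]
  exact continuous_tsum (fun k => (continuous_iterate k).const_mul _) (summable_abs_pow hδ)
    fun k a => abs_term_le δ k (k + 1) a

lemma bddMeas_lamTilde {δ : ℝ} (hδ : |δ| < 1) : BddMeas (lamTilde δ) := by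
  refine ⟨(continuous_lamTilde hδ).measurable, ∑' k : ℕ, |δ| ^ k, fun a => ?_⟩
  rw [lamTilde_eq_tsum hδ]
  exact tsum_of_norm_bounded (f := fun k => δ ^ k * (smooth^[k + 1] treat) a)
    (summable_abs_pow hδ).hasSum fun k => abs_term_le δ k (k + 1) a

lemma bddMeas_lam {δ : ℝ} (hδ : |δ| < 1) : BddMeas (lam δ) := by
  rw [show lam δ = fun a => treat a + δ * lamTilde δ a from funext (lam_eq hδ)]
  exact bddMeas_treat.add ((bddMeas_lamTilde hδ).const_mul δ)

/-- The series may be averaged term by term, with geometric domination; this shifts the iterates by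
one. -/
lemma smooth_lam {δ : ℝ} (hδ : |δ| < 1) : smooth (lam δ) = lamTilde δ := by
  ext a
  rw [lamTilde_eq_tsum hδ, smooth]
  have h := intervalIntegral.hasSum_integral_of_dominated_convergence (μ := volume)
    (a := a - 1) (b := a + 1) (F := fun k u => δ ^ k * (smooth^[k] treat) u) (f := lam δ)
    (fun k _ => |δ| ^ k)
    (fun k => ((bddMeas_iterate k).1.const_mul _).aestronglyMeasurable)
    (fun k => Eventually.of_forall fun u _ => abs_term_le δ k k u)
    (Eventually.of_forall fun _ _ => summable_abs_pow hδ)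
    intervalIntegrable_const
    (Eventually.of_forall fun u _ => (summable_term hδ 0 u).hasSum)
  rw [← h.tsum_eq, ← tsum_mul_left]
  congr 1
  ext k
  rw [intervalIntegral.integral_const_mul, Function.iterate_succ_apply', smooth]
  ring

lemma lamTilde_eq {δ : ℝ} (hδ : |δ| < 1) (a : ℝ) :
    lamTilde δ a = dTilde a + δ * smooth (lamTilde δ) a := by
  conv_lhs => rw [← smooth_lam hδ, show lam δ = fun a => treat a + δ * lamTilde δ a from
    funext (lam_eq hδ)]
  rw [smooth_add bddMeas_treat ((bddMeas_lamTilde hδ).const_mul δ), smooth_treat, smooth_const_mul]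

lemma lamTilde_neg {δ : ℝ} (hδ : |δ| < 1) (a : ℝ) :
    lamTilde δ (-a) = (1 - δ)⁻¹ - lamTilde δ a := by
  rw [lamTilde_eq_tsum hδ, lamTilde_eq_tsum hδ, ← tsum_geometric_of_abs_lt_one hδ,
    ← (summable_geometric_of_abs_lt_one hδ).tsum_sub (summable_term hδ 1 a)]
  congr 1
  ext k
  rw [iterate_neg]
  ring

/-- Every term of the series is eventually equal to `δ ^ k`, and the geometric series dominates. -/
lemma tendsto_lamTilde_atTop {δ : ℝ} (hδ : |δ| < 1) :
    Tendsto (lamTilde δ) atTop (𝓝 (1 - δ)⁻¹) := by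
  rw [show lamTilde δ = fun a => ∑' k, δ ^ k * (smooth^[k + 1] treat) a from
    funext (lamTilde_eq_tsum hδ), ← tsum_geometric_of_abs_lt_one hδ]
  refine tendsto_tsum_of_dominated_convergence (summable_abs_pow hδ) (fun k => ?_)
    (Eventually.of_forall fun a k => abs_term_le δ k (k + 1) a)
  refine tendsto_const_nhds.congr' ?_
  filter_upwards [eventually_ge_atTop ((k + 1 : ℕ) : ℝ)] with a ha
  rw [iterate_eq_one _ ha, mul_one]

lemma tendsto_lamTilde_atBot {δ : ℝ} (hδ : |δ| < 1) : Tendsto (lamTilde δ) atBot (𝓝 0) := by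
  have h := ((tendsto_lamTilde_atTop hδ).comp tendsto_neg_atBot_atTop).const_sub (1 - δ)⁻¹
  rw [sub_self] at h
  refine h.congr fun a => ?_
  rw [Function.comp, lamTilde_neg hδ]
  ring

/-- With `a = 2 * x / c`, the common part of the windows around `a` and `0` cancels in the
difference of averages. Each remainder has length `min a 2`, which is the share `min 1 (x / c)` of
the window length `2`. For `a ≥ 2` the windows overlap in at most a point. -/
lemma contrast_eq {c : ℝ} (hc : 0 < c) {f : ℝ → ℝ} (hf : BddMeas f) {x : ℝ} (hx : 0 ≤ x) :
    contrast c f x = smooth f (2 * x / c) - smooth f 0 := by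
  have hx2 : x / c = (2 * x / c) / 2 := by ring
  have ha : 0 ≤ 2 * x / c := by positivity
  rw [contrast, RPlus, RMinus, hx2]
  generalize 2 * x / c = a at ha
  have avg : ∀ s t : ℝ, s ≤ t → (t - s) * ⨍ u in Icc s t, f u = ∫ u in s..t, f u := by
    intro s t hst
    rw [setAverage_eq, intervalIntegral.integral_of_le hst, integral_Icc_eq_integral_Ioc,
      Real.volume_real_Icc_of_le hst, smul_eq_mul]
    rcases hst.eq_or_lt with rfl | h
    · simp
    · rw [mul_inv_cancel_left₀ (sub_pos.2 h).ne']
  have hi := hf.intervalIntegrable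
  unfold RDSpillover.smooth
  rcases le_total a 2 with h2 | h2
  · have e1 := avg 1 (1 + a) (by linarith)
    have e2 := avg (-1) (a - 1) (by linarith)
    have i1 := intervalIntegral.integral_interval_sub_interval_comm
      (hi (a - 1) (a + 1)) (hi (0 - 1) (0 + 1)) (hi (a - 1) (0 - 1))
    have i2 := intervalIntegral.integral_symm (f := f) (μ := volume) (a - 1) (0 - 1)
    have i3 := intervalIntegral.integral_symm (f := f) (μ := volume) (a + 1) (0 + 1)
    rw [max_eq_left (by linarith), min_eq_right (by linarith), min_eq_right (by linarith)]
    norm_num at i1 i2 i3 ⊢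
    rw [add_comm 1 a] at *
    linarith
  · have e1 := avg (a - 1) (1 + a) (by linarith)
    have e2 := avg (-1) 1 (by linarith)
    rw [max_eq_right (by linarith), min_eq_left (by linarith), min_eq_left (by linarith)]
    norm_num at e1 e2 ⊢
    rw [add_comm 1 a] at *
    linarith

/-! ### Outcomes near the cut-off on the scale of the radius -/

lemma nbhdMean_comp_div {r z : ℝ} (hr : 0 < r) (hz : |z| + r ≤ 1) (g : ℝ → ℝ) :
    nbhdMean r (fun u => g (u / r)) z = smooth g (z / r) := by
  rw [nbhdMean_eq_of_interior hr hz, smooth, intervalIntegral.integral_comp_div _ hr.ne',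
    sub_div, add_div, div_self hr.ne', smul_eq_mul]
  field_simp

lemma abs_nbhdMean_sub_smooth_le {r z S : ℝ} {f g : ℝ → ℝ} (hr : 0 < r) (hz : |z| + r ≤ 1)
    (hf : Integrable f agentLaw) (hg : BddMeas g)
    (hS : ∀ u, |u - z| ≤ r → |f u - g (u / r)| ≤ S) :
    |nbhdMean r f z - smooth g (z / r)| ≤ S := by
  have ha := abs_le.1 (le_refl |z|)
  have hif : IntervalIntegrable f volume (z - r) (z + r) :=
    intervalIntegrable_of_agentLaw hf ⟨by linarith, by linarith⟩ ⟨by linarith, by linarith⟩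
  have hgr : BddMeas fun u => g (u / r) :=
    ⟨hg.1.comp (measurable_id.div_const r), hg.2.choose, fun a => hg.2.choose_spec _⟩
  rw [← nbhdMean_comp_div hr hz, nbhdMean_eq_of_interior hr hz, nbhdMean_eq_of_interior hr hz,
    ← mul_sub, ← intervalIntegral.integral_sub hif (hgr.intervalIntegrable _ _), abs_mul,
    abs_of_pos (by positivity), inv_mul_le_iff₀ (by positivity)]
  have := intervalIntegral.norm_integral_le_of_norm_le_const
    (f := fun u => f u - g (u / r)) (a := z - r) (b := z + r) (C := S) fun u hu => by
      rw [uIoc_of_le (by linarith)] at hu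
      exact hS u (abs_le.2 ⟨by linarith [hu.1], by linarith [hu.2]⟩)
  rw [Real.norm_eq_abs, show z + r - (z - r) = 2 * r by ring, abs_of_pos (by positivity : 0 < 2 * r)]
    at this
  linarith

/-- Each use of the contraction gains a factor `q` and costs one radius of room. After `k` uses the
crude bound `B` has been damped by `q ^ k`, without any information from beyond `ρ`, and the errors
`η` sum to at most a geometric series. -/
lemma abs_le_of_local_contraction {E : ℝ → ℝ} {q r ρ B η : ℝ} (hq : q < 1)
    (hr : 0 < r) (hη : 0 ≤ η) (hB : ∀ z, |z| ≤ ρ → |E z| ≤ B)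
    (hstep : ∀ S z, |z| + r ≤ ρ → (∀ u, |u - z| ≤ r → |E u| ≤ S) → |E z| ≤ q * S + η)
    (k : ℕ) : ∀ z, |z| + k * r ≤ ρ → |E z| ≤ q ^ k * B + η / (1 - q) := by
  have hq1 : 0 < 1 - q := by linarith
  induction k with
  | zero =>
    intro z hz
    have := hB z (by simpa using hz)
    have : 0 ≤ η / (1 - q) := by positivity
    simp only [pow_zero, one_mul]
    linarith
  | succ k ih =>
    intro z hz
    push_cast at hz
    have hk : 0 ≤ (k : ℝ) * r := by positivity
    have h := hstep (q ^ k * B + η / (1 - q)) z (by linarith) fun u hu => ih u (by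
      have := abs_add_le (u - z) z
      rw [sub_add_cancel] at this
      linarith)
    refine h.trans (le_of_eq ?_)
    field_simp
    ring

/-- An approximate solution near the cut-off, on the scale of the radius, of the model with the
scale-invariant treatment assignment `d`. -/
structure Model.IsLocalOutcome (M : Model) (d W : ℝ → ℝ) : Prop where
  bddMeas : BddMeas W
  eq : ∀ a, W a = d a * M.mPlus 0 + (1 - d a) * M.mMinus 0 + M.delta 0 * smooth W a
    + M.gamma 0 * smooth d a

lemma eventually_abs_sub_le_of_continuousOn {f : ℝ → ℝ} (hf : ContinuousOn f agents) {η : ℝ}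
    (hη : 0 < η) : ∀ᶠ z in 𝓝 (0 : ℝ), |f z - f 0| ≤ η := by
  have h0 : agents ∈ 𝓝 (0 : ℝ) := Icc_mem_nhds (by norm_num) (by norm_num)
  have := (hf.continuousAt h0).eventually (Metric.closedBall_mem_nhds (f 0) hη)
  exact this

/-- In a fixed interval around `0`, outcome and limiting solution obey the same equation up to the
oscillation of the coefficients, so their difference is locally contracted by `|δ(0)|`. The number
`k` of contractions depends on `η` only, and `ρ n + k * r n` eventually fits in the interval. No
relation between `ρ` and `r` is needed. -/
lemma Model.Regular.outcome_approx {M : Model} {C : ℝ≥0} {Cδ Cγ δbar : ℝ}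
    (hM : M.Regular C Cδ Cγ δbar) {d W : ℝ → ℝ} (hd0 : ∀ z, 0 ≤ d z) (hd1 : ∀ z, d z ≤ 1)
    (hscale : ∀ r, 0 < r → ∀ z, d (z / r) = d z) (hW : M.IsLocalOutcome d W)
    {r ρ : ℕ → ℝ} (r_pos : ∀ n, 0 < r n) (hr : Tendsto r atTop (𝓝 0))
    (hρ : Tendsto ρ atTop (𝓝 0)) {Y : ℕ → ℝ → ℝ} (hY : ∀ n, M.IsOutcome (r n) d (Y n))
    {η : ℝ} (hη : 0 < η) :
    ∀ᶠ n in atTop, ∀ z, |z| ≤ ρ n → |Y n z - W (z / r n)| ≤ η := by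
  obtain ⟨B, B0, hB⟩ := hM.outcome_bounded
  obtain ⟨D, hD⟩ := hW.bddMeas.2
  set q := |M.delta 0| with hqdef
  have hq : q < 1 := (hM.delta_le 0 zero_mem_agents).trans_lt hM.δbar_lt_one
  have hq1 : 0 < 1 - q := by linarith
  have D0 : 0 ≤ D := (abs_nonneg _).trans (hD 0)
  -- Freezing the coefficients costs `η'` for the two structural functions together, `B * η'` for
  -- `delta` and `η'` for `gamma`; divided by `1 - q`, the total is `η / 2`.
  set η' := η * (1 - q) / (2 * (2 + B)) with hη'
  have hη'0 : 0 < η' := by positivity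
  have hlocal := ((eventually_abs_sub_le_of_continuousOn hM.mPlus_lipschitz.continuousOn hη'0).and
    (eventually_abs_sub_le_of_continuousOn hM.mMinus_lipschitz.continuousOn hη'0)).and
    ((eventually_abs_sub_le_of_continuousOn hM.delta_contDiff.continuousOn hη'0).and
    (eventually_abs_sub_le_of_continuousOn hM.gamma_contDiff.continuousOn hη'0))
  obtain ⟨ρ₁, ρ₁0, hρ₁⟩ := Metric.nhds_basis_closedBall.eventually_iff.1 hlocal
  set ρ₀ := min ρ₁ 1 with hρ₀
  have ρ₀0 : 0 < ρ₀ := lt_min ρ₁0 one_pos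
  have main : ∀ n (k : ℕ) z, |z| + k * r n ≤ ρ₀ →
      |Y n z - W (z / r n)| ≤ q ^ k * (B + D) + (2 + B) * η' / (1 - q) := by
    intro n
    have mem : ∀ z, |z| ≤ ρ₀ → z ∈ agents := fun z hz => abs_le.1 (hz.trans (min_le_right _ _))
    refine abs_le_of_local_contraction (ρ := ρ₀) hq (r_pos n) (by positivity) ?_ ?_
    · intro z hz
      refine (abs_sub _ _).trans (add_le_add (hB _ _ _ (r_pos n) hd0 hd1 (hY n) z (mem z hz)) (hD _))
    · intro S z hz hS
      have hr := r_pos n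
      have hz1 : |z| + r n ≤ 1 := hz.trans (min_le_right _ _)
      have hz0 : z ∈ agents := mem z (by linarith)
      obtain ⟨⟨b1, b2⟩, b3, b4⟩ := hρ₁ (x := z)
        (by rw [Metric.mem_closedBall, Real.dist_eq, sub_zero]; linarith [min_le_left ρ₁ 1])
      have hdbar : nbhdMean (r n) d z = smooth d (z / r n) := by
        rw [← nbhdMean_comp_div hr hz1]; simp only [hscale _ hr]
      have hdm : |nbhdMean (r n) d z| ≤ 1 := abs_nbhdMean_le hr hz0 fun u _ => abs_le.2
        ⟨by linarith [hd0 u], hd1 u⟩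
      have hYm : |nbhdMean (r n) (Y n) z| ≤ B :=
        abs_nbhdMean_le hr hz0 (hB _ _ _ hr hd0 hd1 (hY n))
      have hYW := abs_nbhdMean_sub_smooth_le hr hz1 (hY n).integrable hW.bddMeas hS
      have key : Y n z - W (z / r n) = d z * (M.mPlus z - M.mPlus 0)
          + (1 - d z) * (M.mMinus z - M.mMinus 0) + (M.delta z - M.delta 0) * nbhdMean (r n) (Y n) z
          + M.delta 0 * (nbhdMean (r n) (Y n) z - smooth W (z / r n))
          + (M.gamma z - M.gamma 0) * nbhdMean (r n) d z := by
        rw [(hY n).eq' hz0, hW.eq, hscale _ hr, ← hdbar]; ring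
      have c1 : |d z * (M.mPlus z - M.mPlus 0)| ≤ d z * η' := by
        rw [abs_mul, abs_of_nonneg (hd0 z)]; exact mul_le_mul_of_nonneg_left b1 (hd0 z)
      have c2 : |(1 - d z) * (M.mMinus z - M.mMinus 0)| ≤ (1 - d z) * η' := by
        have : 0 ≤ 1 - d z := by linarith [hd1 z]
        rw [abs_mul, abs_of_nonneg this]; exact mul_le_mul_of_nonneg_left b2 this
      have c3 : |(M.delta z - M.delta 0) * nbhdMean (r n) (Y n) z| ≤ η' * B := by
        rw [abs_mul]; exact mul_le_mul b3 hYm (abs_nonneg _) hη'0.le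
      have c4 : |M.delta 0 * (nbhdMean (r n) (Y n) z - smooth W (z / r n))| ≤ q * S := by
        rw [abs_mul]; exact mul_le_mul_of_nonneg_left hYW (abs_nonneg _)
      have c5 : |(M.gamma z - M.gamma 0) * nbhdMean (r n) d z| ≤ η' * 1 := by
        rw [abs_mul]; exact mul_le_mul b4 hdm (abs_nonneg _) hη'0.le
      rw [key]
      refine (abs_add_le _ _).trans ?_
      have a1 := abs_add_three (d z * (M.mPlus z - M.mPlus 0)
        + (1 - d z) * (M.mMinus z - M.mMinus 0)) ((M.delta z - M.delta 0) * nbhdMean (r n) (Y n) z)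
        (M.delta 0 * (nbhdMean (r n) (Y n) z - smooth W (z / r n)))
      have a2 := abs_add_le (d z * (M.mPlus z - M.mPlus 0)) ((1 - d z) * (M.mMinus z - M.mMinus 0))
      linarith
  have hk : ∃ k : ℕ, q ^ k * (B + D) ≤ η / 2 := by
    have h := (tendsto_pow_atTop_nhds_zero_of_lt_one (abs_nonneg _) hq).mul_const (B + D)
    rw [zero_mul] at h
    exact (h.eventually (Iic_mem_nhds (by positivity : (0 : ℝ) < η / 2))).exists
  obtain ⟨k, hk⟩ := hk
  have hlim : Tendsto (fun n => ρ n + k * r n) atTop (𝓝 0) := by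
    simpa using hρ.add (hr.const_mul (k : ℝ))
  filter_upwards [hlim.eventually (Iic_mem_nhds ρ₀0)] with n hn z hz
  refine (main n k z (by have : ρ n + k * r n ≤ ρ₀ := hn
                         linarith)).trans ?_
  have : (2 + B) * η' / (1 - q) = η / 2 := by rw [hη']; field_simp
  linarith

/-- By linearity, the control level propagates as a constant, the jump of the direct effect as
`lam`, and the exogenous input `dTilde` as `lamTilde`. -/
lemma Model.isLocalOutcome_treat {M : Model} (hδ : |M.delta 0| < 1) :
    M.IsLocalOutcome treat fun a => M.mMinus 0 / (1 - M.delta 0)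
      + (M.directEffect * lam (M.delta 0) a + M.gamma 0 * lamTilde (M.delta 0) a) := by
  have h1 : (1 - M.delta 0) ≠ 0 := by linarith [(abs_lt.1 hδ).2]
  have b1 := (bddMeas_lam hδ).const_mul M.directEffect
  have b2 := (bddMeas_lamTilde hδ).const_mul (M.gamma 0)
  refine ⟨(BddMeas.const _).add (b1.add b2), fun a => ?_⟩
  rw [smooth_add (BddMeas.const _) (b1.add b2), smooth_add b1 b2, smooth_const, smooth_const_mul,
    smooth_const_mul, smooth_lam hδ, smooth_treat, lam_eq hδ]
  conv_lhs => rw [lamTilde_eq hδ]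
  conv_rhs => rw [lamTilde_eq hδ]
  rw [Model.directEffect]
  field_simp
  ring

lemma Model.isLocalOutcome_treatAll {M : Model} (hδ : |M.delta 0| < 1) :
    M.IsLocalOutcome treatAll fun _ => (M.mPlus 0 + M.gamma 0) / (1 - M.delta 0) := by
  have h1 : (1 - M.delta 0) ≠ 0 := by linarith [(abs_lt.1 hδ).2]
  refine ⟨BddMeas.const _, fun a => ?_⟩
  rw [smooth_const, show smooth treatAll a = 1 from smooth_const 1 a, treatAll]
  field_simp
  ring

lemma Model.isLocalOutcome_treatNone {M : Model} (hδ : |M.delta 0| < 1) :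
    M.IsLocalOutcome treatNone fun _ => M.mMinus 0 / (1 - M.delta 0) := by
  have h1 : (1 - M.delta 0) ≠ 0 := by linarith [(abs_lt.1 hδ).2]
  refine ⟨BddMeas.const _, fun a => ?_⟩
  rw [smooth_const, show smooth treatNone a = 0 from smooth_const 0 a, treatNone]
  field_simp
  ring

lemma treat_div {r : ℝ} (hr : 0 < r) (z : ℝ) : treat (z / r) = treat z := by
  rcases lt_or_ge z 0 with h | h
  · rw [treat_of_neg h, treat_of_neg (div_neg_of_neg_of_pos h hr)]
  · rw [treat_of_nonneg h, treat_of_nonneg (by positivity)]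

lemma Model.Regular.tendsto_totalEffect {M : Model} {C : ℝ≥0} {Cδ Cγ δbar : ℝ}
    (hM : M.Regular C Cδ Cγ δbar) {r : ℕ → ℝ} (r_pos : ∀ n, 0 < r n)
    (hr : Tendsto r atTop (𝓝 0)) {Yall Ynone : ℕ → ℝ → ℝ}
    (hall : ∀ n, M.IsOutcome (r n) treatAll (Yall n))
    (hnone : ∀ n, M.IsOutcome (r n) treatNone (Ynone n)) :
    Tendsto (fun n => M.totalEffect (r n) (Yall n) (Ynone n)) atTop
      (𝓝 ((M.directEffect + M.gamma 0) / (1 - M.delta 0))) := by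
  have hδ : |M.delta 0| < 1 := (hM.delta_le 0 zero_mem_agents).trans_lt hM.δbar_lt_one
  have h1 : Tendsto (fun n => Yall n 0) atTop (𝓝 ((M.mPlus 0 + M.gamma 0) / (1 - M.delta 0))) := by
    refine Metric.tendsto_nhds.2 fun η hη => ?_
    filter_upwards [hM.outcome_approx (ρ := fun _ => 0) (fun _ => zero_le_one) (fun _ => le_rfl)
      (fun _ _ _ => rfl) (M.isLocalOutcome_treatAll hδ) r_pos hr tendsto_const_nhds hall
      (half_pos hη)] with n hn
    have := hn 0 (by simp)
    rw [Real.dist_eq]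
    linarith
  have h2 : Tendsto (fun n => Ynone n 0) atTop (𝓝 (M.mMinus 0 / (1 - M.delta 0))) := by
    refine Metric.tendsto_nhds.2 fun η hη => ?_
    filter_upwards [hM.outcome_approx (ρ := fun _ => 0) (fun _ => le_rfl) (fun _ => zero_le_one)
      (fun _ _ _ => rfl) (M.isLocalOutcome_treatNone hδ) r_pos hr tendsto_const_nhds hnone
      (half_pos hη)] with n hn
    have := hn 0 (by simp)
    rw [Real.dist_eq]
    linarith
  convert h1.sub h2 using 1
  · ext n
    rw [Model.totalEffect, (hall n).eq 0 zero_mem_agents, (hnone n).eq 0 zero_mem_agents]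
    simp [treatAll, treatNone]
  · rw [← sub_div, Model.directEffect]
    ring_nf

/-! ### Convergence in probability and the weak law -/

/-- Convergence in probability to constants is preserved by relations that are continuous at the
limit. -/
lemma tendstoInMeasure_of_eventually_near {Ω ι : Type*} [MeasurableSpace Ω] {P : Measure Ω}
    [Fintype ι] {X : ℕ → ι → Ω → ℝ} {c : ι → ℝ}
    (hX : ∀ j, TendstoInMeasure P (fun n => X n j) atTop fun _ => c j)
    {T : ℕ → Ω → ℝ} {τ : ℝ} (Q : (ι → ℝ) → ℝ → Prop) (hQ : ∀ n ω, Q (fun j => X n j ω) (T n ω))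
    (hcont : ∀ η > 0, ∀ᶠ x in 𝓝 c, ∀ t, Q x t → dist t τ < η) :
    TendstoInMeasure P T atTop fun _ => τ := by
  rw [tendstoInMeasure_iff_dist]
  intro η hη
  obtain ⟨ρ, hρ, hball⟩ := Metric.nhds_basis_ball.eventually_iff.1 (hcont η hη)
  have hsum : Tendsto (fun n => ∑ j, P {ω | ρ ≤ dist (X n j ω) (c j)}) atTop (𝓝 0) := by
    have := tendsto_finsetSum Finset.univ fun j _ => tendstoInMeasure_iff_dist.1 (hX j) ρ hρ
    simpa using this
  refine tendsto_of_tendsto_of_tendsto_of_le_of_le tendsto_const_nhds hsum (fun _ => zero_le)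
    fun n => ?_
  refine (measure_mono ?_).trans (measure_iUnion_fintype_le P _)
  intro ω hω
  by_contra hcon
  simp only [mem_iUnion, mem_ofPred_eq, not_exists, not_le] at hcon
  have := hball (x := fun j => X n j ω) ((dist_pi_lt_iff hρ).2 hcon) (T n ω) (hQ n ω)
  exact absurd this (not_lt.2 hω)

lemma tendstoInMeasure_sub {Ω : Type*} [MeasurableSpace Ω] {P : Measure Ω}
    {S T : ℕ → Ω → ℝ} {s t : ℝ} (hS : TendstoInMeasure P S atTop fun _ => s)
    (hT : TendstoInMeasure P T atTop fun _ => t) :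
    TendstoInMeasure P (fun n ω => S n ω - T n ω) atTop fun _ => s - t := by
  refine tendstoInMeasure_of_eventually_near (ι := Bool) (X := fun n j => cond j (S n) (T n))
    (c := fun j => cond j s t) (fun j => by cases j <;> assumption)
    (fun x u => u = x true - x false) (fun _ _ => rfl) fun η hη => ?_
  have hc : ContinuousAt (fun x : Bool → ℝ => x true - x false) fun j => cond j s t := by fun_prop
  filter_upwards [hc (Metric.ball_mem_nhds _ hη)] with x hx u hu
  rw [hu]; exact hx

/-- A weak law of large numbers for kernel-weighted sums in a triangular array. -/
lemma tendstoInMeasure_weighted_sum {Ω : Type*} [MeasurableSpace Ω] {P : Measure Ω}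
    [IsProbabilityMeasure P] {h : ℕ → ℝ} (h_pos : ∀ n, 0 < h n)
    (nh_top : Tendsto (fun n : ℕ => (n : ℝ) * h n) atTop atTop)
    {X : (n : ℕ) → Fin n → Ω → ℝ} (hindep : ∀ n, iIndepFun (X n) P)
    (hL : ∀ n i, MemLp (X n i) 2 P) {μ : ℕ → ℝ} (hmean : ∀ n i, ∫ ω, X n i ω ∂P = h n * μ n)
    {D : ℝ} (hvar : ∀ n i, ∫ ω, X n i ω ^ 2 ∂P ≤ D * h n) {ℓ : ℝ} (hμ : Tendsto μ atTop (𝓝 ℓ)) :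
    TendstoInMeasure P (fun n ω => (n * h n)⁻¹ * ∑ i, X n i ω) atTop fun _ => ℓ := by
  rw [tendstoInMeasure_iff_dist]
  intro η hη
  have hlim : Tendsto (fun n : ℕ => ENNReal.ofReal (D / (η / 2) ^ 2 * (n * h n)⁻¹)) atTop (𝓝 0) := by
    have := (tendsto_inv_atTop_zero.comp nh_top).const_mul (D / (η / 2) ^ 2)
    rw [mul_zero] at this
    simpa using ENNReal.tendsto_ofReal this
  refine tendsto_of_tendsto_of_tendsto_of_le_of_le' tendsto_const_nhds hlim
    (Eventually.of_forall fun _ => zero_le) ?_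
  -- Half of `η` absorbs the bias `μ n - ℓ`; the other half goes to Chebyshev, with a variance of
  -- order `1 / (n * h n)`.
  filter_upwards [hμ.eventually (Metric.ball_mem_nhds ℓ (half_pos hη)), eventually_gt_atTop 0]
    with n hn npos
  have hn0 : (0 : ℝ) < n := by exact_mod_cast npos
  have hh := h_pos n
  set S : Ω → ℝ := fun ω => (n * h n)⁻¹ * (∑ i, X n i) ω with hSdef
  have hSL : MemLp S 2 P := (memLp_finsetSum' _ fun i _ => hL n i).const_mul _
  have hES : ∫ ω, S ω ∂P = μ n := by
    simp only [hSdef, Finset.sum_apply]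
    rw [integral_const_mul, integral_finsetSum _ fun i _ => (hL n i).integrable one_le_two]
    simp only [hmean, Finset.sum_const, Finset.card_univ, Fintype.card_fin, nsmul_eq_mul]
    field_simp
  have hVS : Var[S; P] ≤ D * (n * h n)⁻¹ := by
    rw [hSdef, variance_const_mul, IndepFun.variance_sum (fun i _ => hL n i)
      fun i _ j _ hij => (hindep n).indepFun hij]
    have : ∑ i, Var[X n i; P] ≤ ∑ _i : Fin n, D * h n := Finset.sum_le_sum fun i _ =>
      (variance_le_expectation_sq (hL n i).1).trans (hvar n i)
    rw [Finset.sum_const, Finset.card_univ, Fintype.card_fin, nsmul_eq_mul] at this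
    calc ((n : ℝ) * h n)⁻¹ ^ 2 * ∑ i, Var[X n i; P]
        ≤ ((n : ℝ) * h n)⁻¹ ^ 2 * (n * (D * h n)) := by gcongr
      _ = D * (n * h n)⁻¹ := by field_simp
  calc P {ω | η ≤ dist ((n * h n)⁻¹ * ∑ i, X n i ω) ℓ}
      ≤ P {ω | η / 2 ≤ |S ω - ∫ ω, S ω ∂P|} := by
        refine measure_mono fun ω hω => ?_
        simp only [mem_ofPred_eq] at hω ⊢
        rw [hES, ← Real.dist_eq]
        have h1 : S ω = (n * h n)⁻¹ * ∑ i, X n i ω := by simp [hSdef]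
        rw [h1]
        have h2 := dist_triangle ((n * h n)⁻¹ * ∑ i, X n i ω) (μ n) ℓ
        have h3 : dist (μ n) ℓ < η / 2 := hn
        linarith
    _ ≤ ENNReal.ofReal (Var[S; P] / (η / 2) ^ 2) := meas_ge_le_variance_div_sq hSL (half_pos hη)
    _ ≤ _ := by
        refine ENNReal.ofReal_le_ofReal ?_
        rw [div_mul_eq_mul_div]
        gcongr

/-! ### Moments of weighted observations -/

section Sample

lemma integral_mul_condExp_comap {Ω : Type*} [MeasurableSpace Ω] {P : Measure Ω}
    [IsProbabilityMeasure P] {Z e : Ω → ℝ} (hZ : Measurable Z) (he : Integrable e P)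
    {φ : ℝ → ℝ} (hφ : BddMeas φ) :
    ∫ ω, φ (Z ω) * e ω ∂P =
      ∫ ω, φ (Z ω) * (P[e | MeasurableSpace.comap Z inferInstance]) ω ∂P := by
  obtain ⟨hφm, B, hB⟩ := hφ
  have h1 : StronglyMeasurable[MeasurableSpace.comap Z inferInstance] (φ ∘ Z) :=
    (hφm.comp (comap_measurable Z)).stronglyMeasurable
  have h2 := condExp_stronglyMeasurable_mul_of_bound hZ.comap_le h1 he B
    (Eventually.of_forall fun ω => hB (Z ω))
  exact (integral_condExp hZ.comap_le).symm.trans (integral_congr_ae h2)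

instance : IsProbabilityMeasure agentLaw := ⟨by
  rw [agentLaw, Measure.smul_apply, Measure.restrict_apply_univ, agents, Real.volume_Icc]
  norm_num [ENNReal.inv_mul_cancel]⟩

variable {Ω : Type*} [MeasurableSpace Ω] {P : Measure Ω}
  {Yd : ℝ → ℝ} {σ : ℝ} {n : ℕ} {Y Z ε : Fin n → Ω → ℝ}

lemma IsSample.integral_comp (hS : IsSample P Yd σ Y Z ε) {f : ℝ → ℝ}
    (hf : AEStronglyMeasurable f agentLaw) (i : Fin n) :
    ∫ ω, f (Z i ω) ∂P = ∫ z, f z ∂agentLaw := by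
  rw [← hS.law_Z i, integral_map (hS.measurable_Z i).aemeasurable (by rwa [hS.law_Z i])]

lemma IsSample.aestronglyMeasurable_comp (hS : IsSample P Yd σ Y Z ε) {f : ℝ → ℝ}
    (hf : AEStronglyMeasurable f agentLaw) (i : Fin n) :
    AEStronglyMeasurable (fun ω => f (Z i ω)) P :=
  AEStronglyMeasurable.comp_measurable (by rwa [hS.law_Z i]) (hS.measurable_Z i)

lemma ae_agentLaw_mem : ∀ᵐ z ∂agentLaw, z ∈ agents :=
  Measure.ae_smul_measure (ae_restrict_mem measurableSet_Icc) _

lemma IsSample.ae_mem (hS : IsSample P Yd σ Y Z ε) (i : Fin n) : ∀ᵐ ω ∂P, Z i ω ∈ agents := by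
  have := ae_agentLaw_mem
  rw [← hS.law_Z i] at this
  exact ae_of_ae_map (hS.measurable_Z i).aemeasurable this

variable [IsProbabilityMeasure P]

lemma IsSample.integral_mul_noise (hS : IsSample P Yd σ Y Z ε) {φ : ℝ → ℝ} (hφ : BddMeas φ)
    (i : Fin n) : ∫ ω, φ (Z i ω) * ε i ω ∂P = 0 := by
  rw [integral_mul_condExp_comap (hS.measurable_Z i) ((hS.memLp_noise i).integrable one_le_two) hφ]
  refine integral_eq_zero_of_ae ?_
  filter_upwards [hS.noise_mean i] with ω hω
  rw [hω]; simp

lemma IsSample.integral_mul_noise_sq_le (hS : IsSample P Yd σ Y Z ε) {φ : ℝ → ℝ} (hφ : BddMeas φ)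
    (h0 : ∀ z, 0 ≤ φ z) (i : Fin n) :
    ∫ ω, φ (Z i ω) * ε i ω ^ 2 ∂P ≤ σ ^ 2 * ∫ z, φ z ∂agentLaw := by
  have hi : Integrable (fun ω => φ (Z i ω)) P := by
    obtain ⟨hm, B, hB⟩ := hφ
    exact Integrable.of_bound (hm.comp (hS.measurable_Z i)).aestronglyMeasurable B
      (Eventually.of_forall fun ω => hB _)
  rw [integral_mul_condExp_comap (hS.measurable_Z i) (hS.memLp_noise i).integrable_sq hφ,
    ← hS.integral_comp hφ.1.aestronglyMeasurable i, ← integral_const_mul]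
  have hb : ∀ᵐ ω ∂P, φ (Z i ω) *
      (P[fun ω => ε i ω ^ 2 | MeasurableSpace.comap (Z i) inferInstance]) ω ≤ σ ^ 2 * φ (Z i ω) := by
    filter_upwards [hS.noise_var i] with ω hω
    rw [mul_comm]
    exact mul_le_mul_of_nonneg_right hω (h0 _)
  refine integral_mono_of_nonneg ?_ (hi.const_mul _) hb
  have hnn : 0 ≤ᵐ[P] P[fun ω => ε i ω ^ 2 | MeasurableSpace.comap (Z i) inferInstance] :=
    condExp_nonneg (Eventually.of_forall fun ω => sq_nonneg _)
  filter_upwards [hnn] with ω hω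
  exact mul_nonneg (h0 _) hω

/-- The factor `s` is a switch: `0` for sums of kernel weights, `1` for sums involving outcomes. -/
lemma IsSample.memLp_weighted (hS : IsSample P Yd σ Y Z ε) {φ f : ℝ → ℝ} (hφ : BddMeas φ)
    (hf : AEStronglyMeasurable f agentLaw) {B : ℝ} (hB : ∀ z ∈ agents, |f z| ≤ B) (s : ℝ)
    (i : Fin n) : MemLp (fun ω => φ (Z i ω) * (f (Z i ω) + s * ε i ω)) 2 P := by
  obtain ⟨hm, D, hD⟩ := hφ
  have h1 : MemLp (fun ω => f (Z i ω) + s * ε i ω) 2 P := by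
    refine MemLp.add (f := fun ω => f (Z i ω)) (g := fun ω => s * ε i ω) ?_
      ((hS.memLp_noise i).const_mul s)
    refine MemLp.of_bound (hS.aestronglyMeasurable_comp hf i) B ?_
    filter_upwards [hS.ae_mem i] with ω hω using hB _ hω
  refine MemLp.of_le_mul (c := D) h1
    ((hm.comp (hS.measurable_Z i)).aestronglyMeasurable.mul h1.1) (Eventually.of_forall fun ω => ?_)
  rw [norm_mul]
  gcongr
  exact hD _

lemma IsSample.integral_weighted (hS : IsSample P Yd σ Y Z ε) {φ f : ℝ → ℝ} (hφ : BddMeas φ)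
    (hf : AEStronglyMeasurable f agentLaw) {B : ℝ} (hB : ∀ z ∈ agents, |f z| ≤ B) (s : ℝ)
    (i : Fin n) : ∫ ω, φ (Z i ω) * (f (Z i ω) + s * ε i ω) ∂P = ∫ z, φ z * f z ∂agentLaw := by
  have h1 := (hS.memLp_weighted hφ hf hB 0 i).integrable one_le_two
  have h2 : Integrable (fun ω => s * (φ (Z i ω) * ε i ω)) P := by
    have := ((hS.memLp_weighted hφ (f := fun _ => 0) aestronglyMeasurable_const (B := 0)
      (by simp) 1 i).integrable one_le_two).const_mul s
    simpa using this
  simp only [zero_mul, add_zero] at h1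
  rw [← hS.integral_comp (f := fun z => φ z * f z) (hφ.1.aestronglyMeasurable.mul hf) i, show (fun ω => φ (Z i ω) * (f (Z i ω) + s * ε i ω)) = fun ω => φ (Z i ω) * f (Z i ω)
    + s * (φ (Z i ω) * ε i ω) by ext; ring, integral_add h1 h2, integral_const_mul,
    hS.integral_mul_noise hφ]
  simp

lemma agentLaw_real_Icc_le {h : ℝ} (hh : 0 < h) : agentLaw.real (Icc (-h) h) ≤ h := by
  rw [agentLaw, measureReal_ennreal_smul_apply]
  have h1 : (volume.restrict agents).real (Icc (-h) h) ≤ volume.real (Icc (-h) h) :=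
    ENNReal.toReal_mono (by simp) (Measure.restrict_apply_le _ _)
  rw [Real.volume_real_Icc_of_le (by linarith)] at h1
  simp only [ENNReal.toReal_inv, ENNReal.toReal_ofNat]
  linarith

/-- The factor `h` comes from the support of `φ`: the interval `[-h, h]` has mass at most `h`. The
factor `2` comes from `(a + b)² ≤ 2a² + 2b²`. -/
lemma IsSample.integral_weighted_sq_le (hS : IsSample P Yd σ Y Z ε) {φ f : ℝ → ℝ}
    (hφm : Measurable φ) {D : ℝ} (hD : ∀ z, |φ z| ≤ D) {h : ℝ} (hh : 0 < h)
    (hsupp : ∀ z, h < |z| → φ z = 0)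
    {B : ℝ} (hB : ∀ z ∈ agents, |f z| ≤ B) {s : ℝ} (hs : |s| ≤ 1)
    (i : Fin n) : ∫ ω, (φ (Z i ω) * (f (Z i ω) + s * ε i ω)) ^ 2 ∂P
      ≤ 2 * (B ^ 2 + σ ^ 2) * D ^ 2 * h := by
  have D0 : 0 ≤ D := (abs_nonneg _).trans (hD 0)
  have hφ2 : BddMeas fun z => φ z ^ 2 := ⟨hφm.pow_const 2, D ^ 2, fun a => by
    rw [abs_pow]; exact pow_le_pow_left₀ (abs_nonneg _) (hD a) 2⟩
  have hint : Integrable (fun z => φ z ^ 2) agentLaw :=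
    Integrable.of_bound hφ2.1.aestronglyMeasurable (D ^ 2) (Eventually.of_forall fun a => by
      rw [norm_pow]; exact pow_le_pow_left₀ (abs_nonneg _) (hD a) 2)
  have hφint : ∫ z, φ z ^ 2 ∂agentLaw ≤ D ^ 2 * h := by
    have h1 : ∫ z, φ z ^ 2 ∂agentLaw ≤ ∫ z, (Icc (-h) h).indicator (fun _ => D ^ 2) z ∂agentLaw := by
      refine integral_mono hint ((integrable_const _).indicator measurableSet_Icc) fun z => ?_
      by_cases hz : z ∈ Icc (-h) h
      · simp only [indicator_of_mem hz]
        rw [← sq_abs]; exact pow_le_pow_left₀ (abs_nonneg _) (hD z) 2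
      · simp only [indicator_of_notMem hz]
        rw [hsupp z (by rw [← not_le]; exact fun hc => hz (abs_le.1 hc))]; norm_num
    rw [integral_indicator_const _ measurableSet_Icc, smul_eq_mul] at h1
    have := mul_le_mul_of_nonneg_right (agentLaw_real_Icc_le hh) (sq_nonneg D)
    linarith
  have iZ : Integrable (fun ω => φ (Z i ω) ^ 2) P :=
    Integrable.of_bound (hφ2.1.comp (hS.measurable_Z i)).aestronglyMeasurable (D ^ 2)
      (Eventually.of_forall fun a => by
        rw [norm_pow]; exact pow_le_pow_left₀ (abs_nonneg _) (hD _) 2)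
  have iE : Integrable (fun ω => φ (Z i ω) ^ 2 * ε i ω ^ 2) P := by
    have := (hS.memLp_weighted (φ := φ) ⟨hφm, D, hD⟩ (f := fun _ => 0) aestronglyMeasurable_const
      (B := 0) (by simp) 1 i).integrable_sq
    simpa [mul_pow] using this
  have hpt : ∀ᵐ ω ∂P, (φ (Z i ω) * (f (Z i ω) + s * ε i ω)) ^ 2
      ≤ 2 * B ^ 2 * φ (Z i ω) ^ 2 + 2 * (φ (Z i ω) ^ 2 * ε i ω ^ 2) := by
    filter_upwards [hS.ae_mem i] with ω hω
    have a1 : f (Z i ω) ^ 2 ≤ B ^ 2 := by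
      rw [← sq_abs]; exact pow_le_pow_left₀ (abs_nonneg _) (hB _ hω) 2
    have a2 : s ^ 2 ≤ 1 := by
      rw [← sq_abs]; exact pow_le_one₀ (abs_nonneg _) hs
    have a3 : (f (Z i ω) + s * ε i ω) ^ 2 ≤ 2 * B ^ 2 + 2 * ε i ω ^ 2 := by
      have := mul_le_mul_of_nonneg_right a2 (sq_nonneg (ε i ω))
      nlinarith [sq_nonneg (f (Z i ω) - s * ε i ω)]
    have := mul_le_mul_of_nonneg_left a3 (sq_nonneg (φ (Z i ω)))
    rw [mul_pow]
    linarith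
  refine (integral_mono_of_nonneg (Eventually.of_forall fun _ => sq_nonneg _)
    ((iZ.const_mul _).add (iE.const_mul _)) hpt).trans ?_
  simp only [Pi.add_apply]
  rw [integral_add (iZ.const_mul _) (iE.const_mul _), integral_const_mul, integral_const_mul,
    hS.integral_comp (f := fun z => φ z ^ 2) hφ2.1.aestronglyMeasurable i]
  have := hS.integral_mul_noise_sq_le hφ2 (fun z => sq_nonneg _) i
  have c1 := mul_le_mul_of_nonneg_left hφint (sq_nonneg σ)
  have c2 := mul_le_mul_of_nonneg_left hφint (sq_nonneg B)
  linarith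

end Sample

/-! ### Least squares and the normal equations -/

/-- The kernel-weighted least-squares criterion. -/
noncomputable def crit (k : ℝ → ℝ) (h : ℝ) {n : ℕ} (y z : Fin n → ℝ) (b : ℝ × ℝ) : ℝ :=
  ∑ i, k (z i / h) * (y i - b.1 - b.2 * z i) ^ 2

lemma eq_zero_of_quadratic_nonneg {A B : ℝ} (h : ∀ t : ℝ, 0 ≤ t ^ 2 * B - 2 * t * A) : A = 0 := by
  by_contra hA
  have hB := h A
  rcases le_or_gt B 0 with h0 | h0
  · have h1 := h 1
    have h2 := h (-1)
    have : A = 0 := by linarith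
    exact hA this
  · have := h (A / B)
    have e : (A / B) ^ 2 * B - 2 * (A / B) * A = -(A ^ 2 / B) := by field_simp; ring
    rw [e] at this
    have : 0 < A ^ 2 / B := by positivity
    linarith

/-- Along the line through `b` in direction `(u, v)` the criterion is a quadratic polynomial in `t`,
minimal at `t = 0`, so its linear coefficient vanishes. -/
lemma normal_equation {k : ℝ → ℝ} {h : ℝ} {n : ℕ} {y z : Fin n → ℝ} {b : ℝ × ℝ}
    (hb : IsMinOn (crit k h y z) univ b) (u v : ℝ) :
    ∑ i, k (z i / h) * ((u + v * z i) * (y i - b.1 - b.2 * z i)) = 0 := by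
  refine eq_zero_of_quadratic_nonneg (B := ∑ i, k (z i / h) * (u + v * z i) ^ 2) fun t => ?_
  have := isMinOn_iff.1 hb (b.1 + t * u, b.2 + t * v) (mem_univ _)
  have e : crit k h y z (b.1 + t * u, b.2 + t * v) = crit k h y z b
      + (t ^ 2 * ∑ i, k (z i / h) * (u + v * z i) ^ 2
        - 2 * t * ∑ i, k (z i / h) * ((u + v * z i) * (y i - b.1 - b.2 * z i))) := by
    unfold crit
    rw [Finset.mul_sum, Finset.mul_sum, ← Finset.sum_sub_distrib, ← Finset.sum_add_distrib]
    refine Finset.sum_congr rfl fun i _ => ?_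
    ring
  rw [e] at this
  linarith

/-- Cramer's rule eliminates the slope from the normal equations for the regressors `1` and `z / h`.
The determinant stays on the left because it can vanish on a sample; the identity holds for every
minimizer. -/
lemma intercept_of_isMinOn {k : ℝ → ℝ} {h : ℝ} (hh : h ≠ 0) {n : ℕ} {y z : Fin n → ℝ} {b : ℝ × ℝ}
    (hb : IsMinOn (crit k h y z) univ b) (a w : ℝ) (S V : ℕ → ℝ)
    (hSw : ∀ p, S p = w * ∑ i, k (z i / h) * (z i / h) ^ p)
    (hVw : ∀ p, V p = w * ∑ i, k (z i / h) * (z i / h) ^ p * (y i - a)) :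
    (b.1 - a) * (S 2 * S 0 - S 1 ^ 2) = S 2 * V 0 - S 1 * V 1 := by
  have e0 : V 0 = (b.1 - a) * S 0 + h * b.2 * S 1 := by
    have h0 := normal_equation hb 1 0
    have : V 0 - ((b.1 - a) * S 0 + h * b.2 * S 1)
        = w * ∑ i, k (z i / h) * ((1 + 0 * z i) * (y i - b.1 - b.2 * z i)) := by
      rw [hSw, hVw, hSw]
      simp only [Finset.mul_sum]
      rw [← Finset.sum_add_distrib, ← Finset.sum_sub_distrib]
      refine Finset.sum_congr rfl fun i _ => ?_
      field_simp
      ring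
    rw [h0, mul_zero] at this
    linarith
  have e1 : V 1 = (b.1 - a) * S 1 + h * b.2 * S 2 := by
    have h0 := normal_equation hb 0 (1 / h)
    have : V 1 - ((b.1 - a) * S 1 + h * b.2 * S 2)
        = w * ∑ i, k (z i / h) * ((0 + 1 / h * z i) * (y i - b.1 - b.2 * z i)) := by
      rw [hSw, hVw, hSw]
      simp only [Finset.mul_sum]
      rw [← Finset.sum_add_distrib, ← Finset.sum_sub_distrib]
      refine Finset.sum_congr rfl fun i _ => ?_
      field_simp
      ring
    rw [h0, mul_zero] at this
    linarith
  rw [e0, e1]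
  ring

/-! ### Weight functions and localised means -/

/-- A bounded non-negative weight function supported in `[-1, 1]`. -/
structure IsWeight (k : ℝ → ℝ) (B : ℝ) : Prop where
  measurable : Measurable k
  nonneg : ∀ u, 0 ≤ k u
  le : ∀ u, k u ≤ B
  support : ∀ u, 1 < |u| → k u = 0

/-- The moments of a weight function. -/
noncomputable def mom (k : ℝ → ℝ) (p : ℕ) : ℝ := ∫ x, x ^ p * k x

lemma IsWeight.bound_nonneg {k : ℝ → ℝ} {B : ℝ} (hk : IsWeight k B) : 0 ≤ B :=
  (hk.nonneg 0).trans (hk.le 0)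

lemma IsWeight.abs_pow_mul_le {k : ℝ → ℝ} {B : ℝ} (hk : IsWeight k B) (p : ℕ) (x : ℝ) :
    |x ^ p * k x| ≤ (Icc (-1 : ℝ) 1).indicator (fun _ => B) x := by
  by_cases hx : x ∈ Icc (-1 : ℝ) 1
  · rw [indicator_of_mem hx, abs_mul, abs_pow, abs_of_nonneg (hk.nonneg x)]
    have h1 : |x| ^ p ≤ 1 := pow_le_one₀ (abs_nonneg _) (abs_le.2 hx)
    have := mul_le_mul h1 (hk.le x) (hk.nonneg x) zero_le_one
    linarith
  · rw [indicator_of_notMem hx, hk.support x, mul_zero, abs_zero]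
    rw [← not_le]; exact fun hc => hx (abs_le.1 hc)

lemma integrable_indicator_Icc (B : ℝ) : Integrable ((Icc (-1 : ℝ) 1).indicator fun _ => B) :=
  (integrable_indicator_iff measurableSet_Icc).2 (integrableOn_const (by simp))

lemma IsWeight.integrable_mul {k : ℝ → ℝ} {B : ℝ} (hk : IsWeight k B) (p : ℕ) {f : ℝ → ℝ}
    (hf : Measurable f) {D : ℝ} (hD : ∀ x, |f x| ≤ D) : Integrable fun x => x ^ p * f x * k x := by
  refine Integrable.mono' ((integrable_indicator_Icc B).mul_const D)
    (((measurable_id.pow_const p).mul hf).mul hk.measurable).aestronglyMeasurable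
    (Eventually.of_forall fun x => ?_)
  have hkx := hk.abs_pow_mul_le p x
  rw [show x ^ p * f x * k x = x ^ p * k x * f x by ring, norm_mul]
  exact mul_le_mul hkx (hD x) (abs_nonneg _) ((abs_nonneg _).trans hkx)

lemma IsWeight.integrable_mom {k : ℝ → ℝ} {B : ℝ} (hk : IsWeight k B) (p : ℕ) :
    Integrable fun x => x ^ p * k x := by
  simpa using hk.integrable_mul p (f := fun _ => 1) measurable_const (D := 1) (by simp)

/-- The determinant is `mom k 0` times the integral of `(x - m) ^ 2 * k x`, with `m` the weighted
mean. That integral is positive since the support of `k` has positive measure and removing the point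
`m` does not change this. -/
lemma IsWeight.det_pos {k : ℝ → ℝ} {B : ℝ} (hk : IsWeight k B) (h0 : 0 < mom k 0) :
    0 < mom k 2 * mom k 0 - mom k 1 ^ 2 := by
  set m := mom k 1 / mom k 0 with hm
  have i0 := hk.integrable_mom 0
  have i1 := hk.integrable_mom 1
  have i2 := hk.integrable_mom 2
  have hexp : (fun x => (x - m) ^ 2 * k x) =
      fun x => x ^ 2 * k x - 2 * m * (x ^ 1 * k x) + m ^ 2 * (x ^ 0 * k x) := by ext x; ring
  have hint : Integrable fun x => (x - m) ^ 2 * k x := by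
    rw [hexp]; exact (i2.sub (i1.const_mul _)).add (i0.const_mul _)
  have hval : ∫ x, (x - m) ^ 2 * k x = mom k 2 - 2 * m * mom k 1 + m ^ 2 * mom k 0 := by
    have h1 : Integrable fun x => x ^ 2 * k x - 2 * m * (x ^ 1 * k x) := i2.sub (i1.const_mul _)
    rw [hexp, integral_add h1 (i0.const_mul _),
      integral_sub i2 (i1.const_mul _), integral_const_mul, integral_const_mul]
    rfl
  have hk0 : 0 < volume (Function.support k) := by
    have : 0 < ∫ x, k x := by simpa [mom] using h0
    exact (integral_pos_iff_support_of_nonneg hk.nonneg (by simpa using i0)).1 this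
  have hpos : 0 < ∫ x, (x - m) ^ 2 * k x := by
    rw [integral_pos_iff_support_of_nonneg (fun x => mul_nonneg (sq_nonneg _) (hk.nonneg x)) hint]
    refine hk0.trans_le ?_
    rw [← measure_sdiff_null (s := Function.support k) (Real.volume_singleton (a := m))]
    refine measure_mono fun x hx => ?_
    exact mul_ne_zero (pow_ne_zero 2 (sub_ne_zero.2 hx.2)) hx.1
  rw [hval] at hpos
  have := mul_pos hpos h0
  have e : (mom k 2 - 2 * m * mom k 1 + m ^ 2 * mom k 0) * mom k 0
      = mom k 2 * mom k 0 - mom k 1 ^ 2 := by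
    rw [hm]; field_simp; ring
  rwa [e] at this

lemma measurableSet_agents : MeasurableSet agents := measurableSet_Icc

/-- Local averages with respect to a shrinking weight function converge. -/
lemma IsWeight.tendsto_localMoment {k : ℝ → ℝ} {Kb : ℝ} (hk : IsWeight k Kb) {h : ℕ → ℝ}
    (h_pos : ∀ n, 0 < h n) (h_zero : Tendsto h atTop (𝓝 0)) {f : ℕ → ℝ → ℝ}
    (hf : ∀ n, Integrable (f n) agentLaw) {B : ℝ} (hB : ∀ n, ∀ z ∈ agents, |f n z| ≤ B)
    {L : ℝ → ℝ} (hL : ∀ x, x ≠ 0 → |x| ≤ 1 → k x ≠ 0 →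
      Tendsto (fun n => f n (h n * x)) atTop (𝓝 (L x))) (p : ℕ) :
    Tendsto (fun n => (h n)⁻¹ * ∫ z, k (z / h n) * (z / h n) ^ p * f n z ∂agentLaw) atTop
      (𝓝 (2⁻¹ * ∫ x, x ^ p * L x * k x)) := by
  have hB0 : 0 ≤ B := (abs_nonneg _).trans (hB 0 0 zero_mem_agents)
  have hB' : ∀ n z, |agents.indicator (f n) z| ≤ B := fun n z => by
    by_cases hz : z ∈ agents
    · rw [indicator_of_mem hz]; exact hB n z hz
    · rw [indicator_of_notMem hz, abs_zero]; exact hB0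
  -- Substitution `z = h n * x`, with `f n` extended by zero to the line; `2⁻¹` is the density of
  -- the agents.
  have e : ∀ n, (h n)⁻¹ * ∫ z, k (z / h n) * (z / h n) ^ p * f n z ∂agentLaw
      = 2⁻¹ * ∫ x, x ^ p * agents.indicator (f n) (h n * x) * k x := by
    intro n
    have hn := h_pos n
    have h1 := Measure.integral_comp_mul_left
      (fun z => (z / h n) ^ p * agents.indicator (f n) z * k (z / h n)) (h n)
    simp only [mul_div_cancel_left₀ _ hn.ne', abs_inv, abs_of_pos hn, smul_eq_mul] at h1
    rw [h1, agentLaw, integral_smul_measure, ← integral_indicator measurableSet_agents]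
    simp only [ENNReal.toReal_inv, ENNReal.toReal_ofNat, smul_eq_mul]
    rw [← mul_assoc, mul_comm (h n)⁻¹, mul_assoc]
    congr 3
    ext z
    by_cases hz : z ∈ agents
    · rw [indicator_of_mem hz, indicator_of_mem hz]; ring
    · rw [indicator_of_notMem hz, indicator_of_notMem hz]; ring
  simp only [e]
  refine Tendsto.const_mul _ ?_
  refine tendsto_integral_of_dominated_convergence
    (fun x => (Icc (-1 : ℝ) 1).indicator (fun _ => Kb) x * B) (fun n => ?_)
    ((integrable_indicator_Icc Kb).mul_const B) (fun n => Eventually.of_forall fun x => ?_) ?_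
  · have hi : Integrable (agents.indicator (f n)) :=
      (integrable_indicator_iff measurableSet_Icc).2 (integrable_agentLaw_iff.1 (hf n))
    exact ((measurable_id.pow_const p).aestronglyMeasurable.mul
      (hi.comp_mul_left' (h_pos n).ne').1).mul hk.measurable.aestronglyMeasurable
  · have hkx := hk.abs_pow_mul_le p x
    rw [show x ^ p * agents.indicator (f n) (h n * x) * k x
      = x ^ p * k x * agents.indicator (f n) (h n * x) by ring, norm_mul]
    exact mul_le_mul hkx (hB' n _) (abs_nonneg _) ((abs_nonneg _).trans hkx)
  · have hne : ∀ᵐ x : ℝ, x ≠ 0 := by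
      rw [ae_iff]; simp
    filter_upwards [hne] with x hx
    by_cases hkx : k x = 0
    · simp only [hkx, mul_zero]; exact tendsto_const_nhds
    have hx1 : |x| ≤ 1 := by
      by_contra hc; exact hkx (hk.support x (not_le.1 hc))
    refine Tendsto.mul_const _ (Tendsto.const_mul _ ((hL x hx hx1 hkx).congr' ?_))
    filter_upwards [h_zero.eventually (Iic_mem_nhds one_pos)] with n hn
    rw [indicator_of_mem]
    refine abs_le.1 ?_
    rw [abs_mul, abs_of_pos (h_pos n)]
    exact mul_le_one₀ hn (abs_nonneg _) hx1

/-! ### Consistency of the local linear intercept -/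

section LocalLinear

variable {k : ℝ → ℝ} {Kb : ℝ} {h : ℕ → ℝ} {Ω : Type*} [MeasurableSpace Ω] {P : Measure Ω}
  [IsProbabilityMeasure P] {Yd : ℕ → ℝ → ℝ} {σ : ℝ} {Y Z ε : (n : ℕ) → Fin n → Ω → ℝ}

/-- Independence is given for the pairs `(Y, Z)`, so the summand is written through a measurable `g`
of the pair; its form `f + s * ε` serves to compute moments. -/
lemma IsWeight.tendstoInMeasure_moment (hk : IsWeight k Kb) (h_pos : ∀ n, 0 < h n)
    (h_zero : Tendsto h atTop (𝓝 0)) (nh_top : Tendsto (fun n : ℕ => (n : ℝ) * h n) atTop atTop)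
    (hS : ∀ n, IsSample P (Yd n) σ (Y n) (Z n) (ε n)) {f : ℕ → ℝ → ℝ}
    (hf : ∀ n, Integrable (f n) agentLaw) {B : ℝ} (hB : ∀ n, ∀ z ∈ agents, |f n z| ≤ B)
    {L : ℝ → ℝ} (hL : ∀ x, x ≠ 0 → |x| ≤ 1 → k x ≠ 0 →
      Tendsto (fun n => f n (h n * x)) atTop (𝓝 (L x)))
    {s : ℝ} (hs : |s| ≤ 1) {g : ℕ → ℝ × ℝ → ℝ} (hg : ∀ n, Measurable (g n))
    (hgf : ∀ n i ω, g n (Y n i ω, Z n i ω) = f n (Z n i ω) + s * ε n i ω) (p : ℕ) :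
    TendstoInMeasure P (fun (n : ℕ) ω => ((n : ℝ) * h n)⁻¹ *
        ∑ i, k (Z n i ω / h n) * (Z n i ω / h n) ^ p * g n (Y n i ω, Z n i ω)) atTop
      fun _ => 2⁻¹ * ∫ x, x ^ p * L x * k x := by
  have hφm : ∀ n, Measurable fun z => k (z / h n) * (z / h n) ^ p := fun n =>
    (hk.measurable.comp (measurable_id.div_const _)).mul ((measurable_id.div_const _).pow_const p)
  have hφB : ∀ n z, |k (z / h n) * (z / h n) ^ p| ≤ Kb := fun n z => by
    rw [mul_comm]
    refine (hk.abs_pow_mul_le p _).trans (indicator_le_self' (fun _ _ => hk.bound_nonneg) _)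
  have hsupp : ∀ n z, h n < |z| → k (z / h n) * (z / h n) ^ p = 0 := fun n z hz => by
    rw [hk.support, zero_mul]
    rwa [abs_div, abs_of_pos (h_pos n), one_lt_div (h_pos n)]
  refine tendstoInMeasure_weighted_sum h_pos nh_top
    (X := fun n i ω => k (Z n i ω / h n) * (Z n i ω / h n) ^ p * g n (Y n i ω, Z n i ω))
    (fun n => ?_) (fun n i => ?_) (fun n i => ?_) (D := 2 * (B ^ 2 + σ ^ 2) * Kb ^ 2)
    (fun n i => ?_) (hk.tendsto_localMoment h_pos h_zero hf hB hL p)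
  · exact (hS n).indep.comp (fun _ yz => k (yz.2 / h n) * (yz.2 / h n) ^ p * g n yz) fun _ =>
      ((hφm n).comp measurable_snd).mul (hg n)
  · simp only [hgf]
    exact (hS n).memLp_weighted ⟨hφm n, Kb, hφB n⟩ (hf n).1 (hB n) s i
  · simp only [hgf]
    rw [(hS n).integral_weighted ⟨hφm n, Kb, hφB n⟩ (hf n).1 (hB n) s i,
      mul_inv_cancel_left₀ (h_pos n).ne']
  · simp only [hgf]
    exact (hS n).integral_weighted_sq_le (hφm n) (hφB n) (h_pos n) (hsupp n) (hB n) hs i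

/-- Consistency of the intercept of the local linear fit, up to a centring sequence `a`. -/
lemma IsWeight.tendstoInMeasure_intercept (hk : IsWeight k Kb) (hk0 : 0 < mom k 0)
    (h_pos : ∀ n, 0 < h n) (h_zero : Tendsto h atTop (𝓝 0))
    (nh_top : Tendsto (fun n : ℕ => (n : ℝ) * h n) atTop atTop)
    (hS : ∀ n, IsSample P (Yd n) σ (Y n) (Z n) (ε n)) (hYd : ∀ n, Integrable (Yd n) agentLaw)
    {B : ℝ} (hB : ∀ n, ∀ z ∈ agents, |Yd n z| ≤ B) {a : ℕ → ℝ} {A : ℝ} (hA : ∀ n, |a n| ≤ A)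
    {L : ℝ → ℝ} (hL : ∀ x, x ≠ 0 → |x| ≤ 1 → k x ≠ 0 →
      Tendsto (fun n => Yd n (h n * x) - a n) atTop (𝓝 (L x)))
    {b : ℕ → Ω → ℝ × ℝ}
    (hb : ∀ n ω, IsMinOn (crit k (h n) (fun i => Y n i ω) fun i => Z n i ω) univ (b n ω)) :
    TendstoInMeasure P (fun n ω => (b n ω).1 - a n) atTop fun _ =>
      (mom k 2 * (∫ x, x ^ 0 * L x * k x) - mom k 1 * ∫ x, x ^ 1 * L x * k x)
        / (mom k 2 * mom k 0 - mom k 1 ^ 2) := by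
  have hdet := hk.det_pos hk0
  set I0 := ∫ x, x ^ 0 * L x * k x
  set I1 := ∫ x, x ^ 1 * L x * k x
  have cS := hk.tendstoInMeasure_moment h_pos h_zero nh_top hS (f := fun _ _ => 1)
    (fun _ => integrable_const _) (B := 1) (by simp) (L := fun _ => 1)
    (fun _ _ _ _ => tendsto_const_nhds) (s := 0) (by simp) (g := fun _ _ => 1)
    (fun _ => measurable_const) (by simp)
  have cV := hk.tendstoInMeasure_moment h_pos h_zero nh_top hS (f := fun n z => Yd n z - a n)
    (fun n => (hYd n).sub (integrable_const _)) (B := B + A)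
    (fun n z hz => (abs_sub _ _).trans (add_le_add (hB n z hz) (hA n))) hL
    (s := 1) (by simp) (g := fun n yz => yz.1 - a n) (fun n => measurable_fst.sub_const _)
    (fun n i ω => by simp only [(hS n).outcome i ω]; ring)
  simp only [mul_one] at cS
  set S : ℕ → ℕ → Ω → ℝ := fun n p ω =>
    ((n : ℝ) * h n)⁻¹ * ∑ i, k (Z n i ω / h n) * (Z n i ω / h n) ^ p with hSdef
  set V : ℕ → ℕ → Ω → ℝ := fun n p ω => ((n : ℝ) * h n)⁻¹ *
    ∑ i, k (Z n i ω / h n) * (Z n i ω / h n) ^ p * (Y n i ω - a n) with hVdef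
  let X : ℕ → Fin 5 → Ω → ℝ := fun n => ![S n 0, S n 1, S n 2, V n 0, V n 1]
  let c : Fin 5 → ℝ := ![2⁻¹ * mom k 0, 2⁻¹ * mom k 1, 2⁻¹ * mom k 2, 2⁻¹ * I0, 2⁻¹ * I1]
  -- The Cramer identity determines the intercept only where the determinant is non-zero, which
  -- holds near the limit point; hence a relation rather than a function of the five moments.
  refine tendstoInMeasure_of_eventually_near (X := X) (c := c) ?_
    (fun x t => t * (x 2 * x 0 - x 1 ^ 2) = x 2 * x 3 - x 1 * x 4) (fun n ω => ?_) fun η hη => ?_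
  · intro j
    fin_cases j
    · exact cS 0
    · exact cS 1
    · exact cS 2
    · exact cV 0
    · exact cV 1
  · exact intercept_of_isMinOn (h_pos n).ne' (hb n ω) (a n) ((n : ℝ) * h n)⁻¹ (fun p => S n p ω)
      (fun p => V n p ω) (fun _ => rfl) fun _ => rfl
  · have hc : c 2 * c 0 - c 1 ^ 2 = 4⁻¹ * (mom k 2 * mom k 0 - mom k 1 ^ 2) := by
      simp only [c, Matrix.cons_val]; ring
    have hc0 : 0 < c 2 * c 0 - c 1 ^ 2 := by rw [hc]; positivity
    have hcont : ContinuousAt (fun x : Fin 5 → ℝ =>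
        (x 2 * x 3 - x 1 * x 4) / (x 2 * x 0 - x 1 ^ 2)) c := by
      refine ContinuousAt.div (by fun_prop) (by fun_prop) hc0.ne'
    have hval : (c 2 * c 3 - c 1 * c 4) / (c 2 * c 0 - c 1 ^ 2)
        = (mom k 2 * I0 - mom k 1 * I1) / (mom k 2 * mom k 0 - mom k 1 ^ 2) := by
      rw [hc, div_eq_div_iff (by positivity) hdet.ne']
      simp only [c, Matrix.cons_val]; ring
    have hpos : ∀ᶠ x : Fin 5 → ℝ in 𝓝 c, 0 < x 2 * x 0 - x 1 ^ 2 := by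
      have : ContinuousAt (fun x : Fin 5 → ℝ => x 2 * x 0 - x 1 ^ 2) c := by fun_prop
      exact this.eventually (lt_mem_nhds hc0)
    filter_upwards [hpos, hcont.eventually (Metric.ball_mem_nhds _ hη)] with x hx1 hx2 t ht
    rw [← hval, (eq_div_iff hx1.ne').2 ht]
    exact hx2

end LocalLinear

/-! ### One-sided kernels -/

lemma IsKernel.isWeight_indicator {K : ℝ → ℝ} {Kbar : ℝ} (hK : IsKernel K Kbar) {s : Set ℝ}
    (hs : MeasurableSet s) : IsWeight (s.indicator K) Kbar where
  measurable := hK.measurable.indicator hs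
  nonneg := indicator_nonneg fun u _ => hK.nonneg u
  le u := indicator_le' (fun u _ => hK.le u) (fun _ _ => (hK.nonneg 0).trans (hK.le 0)) u
  support u hu := by
    have : K u = 0 := hK.support u (by
      rcases lt_abs.1 hu with h | h
      · exact Or.inr h
      · exact Or.inl (by linarith))
    simp [indicator, this]

lemma IsKernel.integral_indicator_Ici {K : ℝ → ℝ} {Kbar : ℝ} (hK : IsKernel K Kbar) (F : ℝ → ℝ) :
    ∫ x, F x * (Ici (0 : ℝ)).indicator K x = ∫ x in (0 : ℝ)..1, F x * K x := by
  rw [intervalIntegral.integral_of_le zero_le_one, ← integral_Icc_eq_integral_Ioc,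
    ← integral_indicator measurableSet_Icc]
  congr 1
  ext x
  by_cases h0 : 0 ≤ x
  · by_cases h1 : x ≤ 1
    · rw [indicator_of_mem (show x ∈ Ici 0 from h0), indicator_of_mem (show x ∈ Icc 0 1 from ⟨h0, h1⟩)]
    · rw [indicator_of_mem (show x ∈ Ici 0 from h0), indicator_of_notMem fun h => h1 h.2,
        hK.support x (Or.inr (not_le.1 h1)), mul_zero]
  · rw [indicator_of_notMem (show x ∉ Ici 0 from h0), indicator_of_notMem fun h => h0 h.1, mul_zero]

lemma IsKernel.integral_indicator_Iio {K : ℝ → ℝ} {Kbar : ℝ} (hK : IsKernel K Kbar) (F : ℝ → ℝ) :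
    ∫ x, F x * (Iio (0 : ℝ)).indicator K x = ∫ x in (-1 : ℝ)..0, F x * K x := by
  rw [intervalIntegral.integral_of_le (by norm_num), ← integral_Ico_eq_integral_Ioc,
    ← integral_indicator measurableSet_Ico]
  congr 1
  ext x
  by_cases h0 : x < 0
  · by_cases h1 : -1 ≤ x
    · rw [indicator_of_mem (show x ∈ Iio 0 from h0), indicator_of_mem (show x ∈ Ico (-1) 0 from ⟨h1, h0⟩)]
    · rw [indicator_of_mem (show x ∈ Iio 0 from h0), indicator_of_notMem fun h => h1 h.1,
        hK.support x (Or.inl (not_le.1 h1)), mul_zero]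
  · rw [indicator_of_notMem (show x ∉ Iio 0 from h0), indicator_of_notMem fun h => h0 h.2, mul_zero]

lemma IsKernel.mom_indicator_Ici {K : ℝ → ℝ} {Kbar : ℝ} (hK : IsKernel K Kbar) :
    mom ((Ici 0).indicator K) = momPlus K :=
  funext fun p => hK.integral_indicator_Ici (fun x => x ^ p)

lemma IsKernel.mom_indicator_Iio {K : ℝ → ℝ} {Kbar : ℝ} (hK : IsKernel K Kbar) :
    mom ((Iio 0).indicator K) = momMinus K :=
  funext fun p => hK.integral_indicator_Iio (fun x => x ^ p)

lemma IsWeight.mom_zero_nonneg {k : ℝ → ℝ} {B : ℝ} (hk : IsWeight k B) : 0 ≤ mom k 0 :=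
  integral_nonneg fun x => by simpa using hk.nonneg x

lemma IsWeight.mom_one_eq_zero {k : ℝ → ℝ} {B : ℝ} (hk : IsWeight k B) (h : mom k 0 = 0) :
    mom k 1 = 0 := by
  rw [mom, integral_eq_zero_iff_of_nonneg (fun x => by simpa using hk.nonneg x)
    (hk.integrable_mom 0)] at h
  refine integral_eq_zero_of_ae ?_
  filter_upwards [h] with x hx
  simp only [pow_zero, one_mul, Pi.zero_apply] at hx
  simp [hx]

lemma IsWeight.mom_zero_eq_zero {k : ℝ → ℝ} {B : ℝ} (hk : IsWeight k B) (s : ℝ)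
    (hs : ∀ x, 0 ≤ s * (x ^ 1 * k x)) (hs0 : s ≠ 0) (h : mom k 1 = 0) : mom k 0 = 0 := by
  have h1 : ∫ x, s * (x ^ 1 * k x) = 0 := by
    rw [integral_const_mul]; exact mul_eq_zero_of_right _ h
  rw [integral_eq_zero_iff_of_nonneg hs ((hk.integrable_mom 1).const_mul s)] at h1
  have hne : ∀ᵐ x : ℝ, x ≠ 0 := by
    rw [ae_iff]; simp
  refine integral_eq_zero_of_ae ?_
  filter_upwards [h1, hne] with x hx hx0
  simp only [pow_one, Pi.zero_apply, mul_eq_zero, hs0, hx0, false_or] at hx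
  simp [hx]

/-- If one half of the kernel had no mass, its first moment would vanish, hence also that of the
other half, because the total first moment is zero. As `x` has constant sign there, the other half
would be null too, contradicting total mass one. -/
lemma IsKernel.mom_pos {K : ℝ → ℝ} {Kbar : ℝ} (hK : IsKernel K Kbar) :
    0 < mom ((Ici 0).indicator K) 0 ∧ 0 < mom ((Iio 0).indicator K) 0 := by
  have hp := hK.isWeight_indicator (s := Ici 0) measurableSet_Ici
  have hm := hK.isWeight_indicator (s := Iio 0) measurableSet_Iio
  have add : ∀ p, mom ((Ici 0).indicator K) p + mom ((Iio 0).indicator K) p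
      = ∫ u in (-1 : ℝ)..1, u ^ p * K u := by
    intro p
    rw [mom, mom, ← integral_add (hp.integrable_mom p) (hm.integrable_mom p),
      intervalIntegral.integral_of_le (by norm_num), ← integral_Icc_eq_integral_Ioc,
      ← integral_indicator measurableSet_Icc]
    congr 1
    ext x
    have : (Ici (0 : ℝ)).indicator K x + (Iio (0 : ℝ)).indicator K x = K x := by
      have := indicator_self_add_compl (Ici (0 : ℝ)) K
      rw [compl_Ici] at this
      exact congrFun this x
    rw [← mul_add, this]
    by_cases hx : x ∈ Icc (-1 : ℝ) 1
    · rw [indicator_of_mem hx]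
    · rw [indicator_of_notMem hx, hK.support x, mul_zero]
      by_contra hc
      push Not at hc
      exact hx hc
  have a0 := add 0
  have a1 := add 1
  simp only [pow_zero, one_mul, pow_one, hK.integral_one, hK.integral_id] at a0 a1
  have sp : mom ((Ici 0).indicator K) 1 = 0 → mom ((Ici 0).indicator K) 0 = 0 :=
    hp.mom_zero_eq_zero 1 (fun x => by
      by_cases hx : x ∈ Ici (0 : ℝ)
      · have := mul_nonneg hx (hp.nonneg x)
        simpa using this
      · rw [indicator_of_notMem hx]; simp) one_ne_zero
  have sm : mom ((Iio 0).indicator K) 1 = 0 → mom ((Iio 0).indicator K) 0 = 0 :=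
    hm.mom_zero_eq_zero (-1) (fun x => by
      by_cases hx : x ∈ Iio (0 : ℝ)
      · have := mul_nonneg (neg_nonneg.2 (le_of_lt hx)) (hm.nonneg x)
        linarith
      · rw [indicator_of_notMem hx]; simp) (by norm_num)
  constructor
  · refine hp.mom_zero_nonneg.lt_of_ne fun h => ?_
    have h1 := hp.mom_one_eq_zero h.symm
    have := sm (by linarith)
    linarith
  · refine hm.mom_zero_nonneg.lt_of_ne fun h => ?_
    have h1 := hm.mom_one_eq_zero h.symm
    have := sp (by linarith)
    linarith

lemma critPlus_eq {K : ℝ → ℝ} {h : ℝ} (hh : 0 < h) {n : ℕ} (y z : Fin n → ℝ) :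
    critPlus K h y z = crit ((Ici 0).indicator K) h y z := by
  ext b
  rw [critPlus, crit, Finset.sum_filter]
  refine Finset.sum_congr rfl fun i _ => ?_
  by_cases hz : 0 ≤ z i
  · rw [if_pos hz, indicator_of_mem (show z i / h ∈ Ici 0 from div_nonneg hz hh.le)]
  · rw [if_neg hz, indicator_of_notMem, zero_mul]
    exact not_le.2 (div_neg_of_neg_of_pos (not_le.1 hz) hh)

lemma critMinus_eq {K : ℝ → ℝ} {h : ℝ} (hh : 0 < h) {n : ℕ} (y z : Fin n → ℝ) :
    critMinus K h y z = crit ((Iio 0).indicator K) h y z := by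
  ext b
  rw [critMinus, crit, Finset.sum_filter]
  refine Finset.sum_congr rfl fun i _ => ?_
  by_cases hz : z i < 0
  · rw [if_pos hz, indicator_of_mem (show z i / h ∈ Iio 0 from div_neg_of_neg_of_pos hz hh)]
  · rw [if_neg hz, indicator_of_notMem, zero_mul]
    exact not_lt.2 (div_nonneg (not_lt.1 hz) hh.le)

/-! ### The estimator under pointwise convergence of the rescaled outcomes -/

/-- Shifting all outcomes by `a n` shifts both intercepts equally. The level of outcomes near the
cut-off therefore need not converge. -/
lemma rdd_tendstoInMeasure {K : ℝ → ℝ} {Kbar : ℝ} (hK : IsKernel K Kbar)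
    {h : ℕ → ℝ} (h_pos : ∀ n, 0 < h n) (h_zero : Tendsto h atTop (𝓝 0))
    (nh_top : Tendsto (fun n : ℕ => (n : ℝ) * h n) atTop atTop)
    {Ω : Type*} [MeasurableSpace Ω] {P : Measure Ω} [IsProbabilityMeasure P]
    {Yd : ℕ → ℝ → ℝ} {σ : ℝ} {Y Z ε : (n : ℕ) → Fin n → Ω → ℝ}
    (hS : ∀ n, IsSample P (Yd n) σ (Y n) (Z n) (ε n)) (hYd : ∀ n, Integrable (Yd n) agentLaw)
    {τhat : ℕ → Ω → ℝ}
    (hτ : ∀ n ω, IsRDDEstimate K (h n) (fun i => Y n i ω) (fun i => Z n i ω) (τhat n ω))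
    {B : ℝ} (hB : ∀ n, ∀ z ∈ agents, |Yd n z| ≤ B) {a : ℕ → ℝ} {A : ℝ} (hA : ∀ n, |a n| ≤ A)
    {LP LM : ℝ → ℝ}
    (hLP : ∀ x, 0 < x → Tendsto (fun n => Yd n (h n * x) - a n) atTop (𝓝 (LP x)))
    (hLM : ∀ x, x < 0 → Tendsto (fun n => Yd n (h n * x) - a n) atTop (𝓝 (LM x))) :
    TendstoInMeasure P τhat atTop fun _ =>
      fitPlus K (fun p => ∫ x in (0 : ℝ)..1, x ^ p * LP x * K x)
        - fitMinus K (fun p => ∫ x in (-1 : ℝ)..0, x ^ p * LM x * K x) := by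
  choose bp bm hbp hbm hτeq using hτ
  simp only [critPlus_eq (h_pos _)] at hbp
  simp only [critMinus_eq (h_pos _)] at hbm
  have cp := (hK.isWeight_indicator measurableSet_Ici).tendstoInMeasure_intercept hK.mom_pos.1
    h_pos h_zero nh_top hS hYd hB hA (L := LP) (fun x hx _ hkx => hLP x (lt_of_le_of_ne
      (by by_contra hc; exact hkx (indicator_of_notMem hc _)) hx.symm)) hbp
  have cm := (hK.isWeight_indicator measurableSet_Iio).tendstoInMeasure_intercept hK.mom_pos.2
    h_pos h_zero nh_top hS hYd hB hA (L := LM) (fun x hx _ hkx => hLM x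
      (by by_contra hc; exact hkx (indicator_of_notMem (s := Iio 0) hc _))) hbm
  have e : τhat = fun n ω => ((bp n ω).1 - a n) - ((bm n ω).1 - a n) := by
    ext n ω; rw [hτeq]; ring
  rw [e]
  convert tendstoInMeasure_sub cp cm using 3
  · simp only [fitPlus, hK.mom_indicator_Ici, hK.integral_indicator_Ici fun x => x ^ _ * LP x]
  · simp only [fitMinus, hK.mom_indicator_Iio, hK.integral_indicator_Iio fun x => x ^ _ * LM x]

lemma IsKernel.fitPlus_const {K : ℝ → ℝ} {Kbar : ℝ} (hK : IsKernel K Kbar) (C : ℝ) :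
    fitPlus K (fun p => ∫ x in (0 : ℝ)..1, x ^ p * C * K x) = C := by
  have hdet := (hK.isWeight_indicator measurableSet_Ici).det_pos hK.mom_pos.1
  rw [hK.mom_indicator_Ici] at hdet
  have e : ∀ p, ∫ x in (0 : ℝ)..1, x ^ p * C * K x = C * momPlus K p := fun p => by
    rw [momPlus, ← intervalIntegral.integral_const_mul]
    congr 1; ext x; ring
  simp only [fitPlus, e]
  rw [div_eq_iff hdet.ne']
  ring

lemma IsKernel.fitMinus_const {K : ℝ → ℝ} {Kbar : ℝ} (hK : IsKernel K Kbar) (C : ℝ) :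
    fitMinus K (fun p => ∫ x in (-1 : ℝ)..0, x ^ p * C * K x) = C := by
  have hdet := (hK.isWeight_indicator measurableSet_Iio).det_pos hK.mom_pos.2
  rw [hK.mom_indicator_Iio] at hdet
  have e : ∀ p, ∫ x in (-1 : ℝ)..0, x ^ p * C * K x = C * momMinus K p := fun p => by
    rw [momMinus, ← intervalIntegral.integral_const_mul]
    congr 1; ext x; ring
  simp only [fitMinus, e]
  rw [div_eq_iff hdet.ne']
  ring

/-! ### Rescaled outcomes -/

section Rescaled

variable {M : Model} {C : ℝ≥0} {Cδ Cγ δbar : ℝ} {h r : ℕ → ℝ} {Yd : ℕ → ℝ → ℝ}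

/-- The ratio of `h` to `r` enters only through the limit of `lamTilde`, so the same lemma serves
arguments with finite and with infinite limits. -/
lemma Model.Regular.tendsto_rescaled (hM : M.Regular C Cδ Cγ δbar) (h_pos : ∀ n, 0 < h n)
    (r_pos : ∀ n, 0 < r n) (h_zero : Tendsto h atTop (𝓝 0)) (r_zero : Tendsto r atTop (𝓝 0))
    (hYd : ∀ n, M.IsOutcome (r n) treat (Yd n)) {x ℓ : ℝ}
    (hℓ : Tendsto (fun n => lamTilde (M.delta 0) (h n * x / r n)) atTop (𝓝 ℓ)) :
    Tendsto (fun n => Yd n (h n * x)) atTop (𝓝 (M.mMinus 0 / (1 - M.delta 0)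
      + (M.directEffect * (treat x + M.delta 0 * ℓ) + M.gamma 0 * ℓ))) := by
  have hδ : |M.delta 0| < 1 := (hM.delta_le 0 zero_mem_agents).trans_lt hM.δbar_lt_one
  have hW : Tendsto (fun n => M.mMinus 0 / (1 - M.delta 0)
      + (M.directEffect * lam (M.delta 0) (h n * x / r n)
        + M.gamma 0 * lamTilde (M.delta 0) (h n * x / r n))) atTop
      (𝓝 (M.mMinus 0 / (1 - M.delta 0)
      + (M.directEffect * (treat x + M.delta 0 * ℓ) + M.gamma 0 * ℓ))) := by
    have ht : ∀ n, treat (h n * x / r n) = treat x := fun n => by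
      rw [treat_div (r_pos n), ← treat_div (inv_pos.2 (h_pos n)) x, div_inv_eq_mul, mul_comm]
    simp only [lam_eq hδ, ht]
    exact (((hℓ.const_mul _).const_add _ |>.const_mul _).add (hℓ.const_mul _)).const_add _
  have hdiff : Tendsto (fun n => Yd n (h n * x) - (M.mMinus 0 / (1 - M.delta 0)
      + (M.directEffect * lam (M.delta 0) (h n * x / r n)
        + M.gamma 0 * lamTilde (M.delta 0) (h n * x / r n)))) atTop (𝓝 0) := by
    refine Metric.tendsto_nhds.2 fun η hη => ?_
    have hρ : Tendsto (fun n => |h n * x|) atTop (𝓝 0) := by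
      simpa using (h_zero.mul_const x).abs
    filter_upwards [hM.outcome_approx treat_nonneg treat_le_one (fun _ => treat_div)
      (M.isLocalOutcome_treat hδ) r_pos r_zero hρ hYd (half_pos hη)] with n hn
    have := hn _ le_rfl
    rw [Real.dist_eq, sub_zero]
    linarith
  simpa using hdiff.add hW

/-- The radius need not tend to zero, so the local equation is not available. Instead the
neighbourhood means at `h n * x` and `0` merge by `abs_nbhdMean_sub_le`, and the centring removes
the spillovers received at `0`. -/
lemma Model.Regular.tendsto_outcome_of_large_radius (hM : M.Regular C Cδ Cγ δbar)
    (h_pos : ∀ n, 0 < h n) (r_pos : ∀ n, 0 < r n) (h_zero : Tendsto h atTop (𝓝 0))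
    (hr : Tendsto (fun n => r n / h n) atTop atTop)
    (hYd : ∀ n, M.IsOutcome (r n) treat (Yd n)) (x : ℝ) :
    Tendsto (fun n => Yd n (h n * x) - (M.mMinus 0 + M.delta 0 * nbhdMean (r n) (Yd n) 0
      + M.gamma 0 * nbhdMean (r n) treat 0)) atTop (𝓝 (treat x * M.directEffect)) := by
  obtain ⟨B, B0, hB⟩ := hM.outcome_bounded
  have hB' : ∀ n, ∀ z ∈ agents, |Yd n z| ≤ B := fun n =>
    hB _ _ _ (r_pos n) treat_nonneg treat_le_one (hYd n)
  have htreat : ∀ u ∈ agents, |treat u| ≤ 1 := fun u _ => abs_le.2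
    ⟨by linarith [treat_nonneg u], treat_le_one u⟩
  have itreat : Integrable treat agentLaw :=
    Integrable.of_bound measurable_treat.aestronglyMeasurable 1
      (Eventually.of_forall fun u => abs_le.2 ⟨by linarith [treat_nonneg u], treat_le_one u⟩)
  have hz : Tendsto (fun n => h n * x) atTop (𝓝 0) := by simpa using h_zero.mul_const x
  have hagents : agents ∈ 𝓝 (0 : ℝ) := Icc_mem_nhds (by norm_num) (by norm_num)
  have hmem : ∀ᶠ n in atTop, h n * x ∈ agents := hz.eventually hagents
  have lim : ∀ {f : ℝ → ℝ}, ContinuousOn f agents →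
      Tendsto (fun n => f (h n * x)) atTop (𝓝 (f 0)) := fun hf =>
    (hf.continuousAt hagents).tendsto.comp hz
  have hp := lim hM.mPlus_lipschitz.continuousOn
  have hm := lim hM.mMinus_lipschitz.continuousOn
  have hδ := lim hM.delta_contDiff.continuousOn
  have hγ := lim hM.gamma_contDiff.continuousOn
  -- The quotient by the minimum is at most the sum of the quotients by `r n` and by `1`, which both
  -- vanish.
  have hratio : Tendsto (fun n => |h n * x| / min (r n) 1) atTop (𝓝 0) := by
    have h1 : Tendsto (fun n => |x| * (r n / h n)⁻¹ + |h n * x|) atTop (𝓝 0) := by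
      simpa using ((tendsto_inv_atTop_zero.comp hr).const_mul |x|).add hz.abs
    refine squeeze_zero (fun n => by have := r_pos n; positivity) (fun n => ?_) h1
    have hn := h_pos n
    have hrn := r_pos n
    have e : |x| * (r n / h n)⁻¹ = |h n * x| / r n := by
      rw [abs_mul, abs_of_pos hn, inv_div]; ring
    rw [e]
    rcases min_choice (r n) 1 with h' | h' <;> rw [h']
    · linarith [abs_nonneg (h n * x)]
    · rw [div_one]
      have : 0 ≤ |h n * x| / r n := by positivity
      linarith
  have mean : ∀ {f : ℕ → ℝ → ℝ} {D : ℝ}, (∀ n, Integrable (f n) agentLaw) →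
      (∀ n, ∀ u ∈ agents, |f n u| ≤ D) →
      Tendsto (fun n => nbhdMean (r n) (f n) (h n * x) - nbhdMean (r n) (f n) 0) atTop (𝓝 0) := by
    intro f D hf hD
    refine squeeze_zero_norm' ?_ (mul_zero (4 * D) ▸ hratio.const_mul (4 * D))
    filter_upwards [hmem] with n hn
    exact abs_nbhdMean_sub_le (r_pos n) hn (hf n) (hD n)
  have prod : ∀ {f : ℕ → ℝ → ℝ} {D : ℝ} {u : ℕ → ℝ}, (∀ n, ∀ u ∈ agents, |f n u| ≤ D) →
      Tendsto u atTop (𝓝 0) → Tendsto (fun n => u n * nbhdMean (r n) (f n) (h n * x)) atTop (𝓝 0) := by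
    intro f D u hD hu
    have h1 : Tendsto (fun n => |u n| * D) atTop (𝓝 0) := by simpa using hu.abs.mul_const D
    refine squeeze_zero_norm' ?_ h1
    filter_upwards [hmem] with n hn
    rw [norm_mul]
    exact mul_le_mul_of_nonneg_left (abs_nbhdMean_le (r_pos n) hn (hD n)) (abs_nonneg _)
  have t1 := mean (fun n => (hYd n).integrable) hB'
  have t2 := mean (f := fun _ => treat) (fun _ => itreat) fun _ => htreat
  have t3 := prod hB' (by simpa using hδ.sub_const (M.delta 0))
  have t4 := prod (f := fun _ => treat) (fun _ => htreat) (by simpa using hγ.sub_const (M.gamma 0))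
  have main := ((((hp.const_mul (treat x)).add (hm.const_mul (1 - treat x))).sub_const
    (M.mMinus 0)).add ((t1.const_mul (M.delta 0)).add (t2.const_mul (M.gamma 0)))).add (t3.add t4)
  have e : treat x * M.mPlus 0 + (1 - treat x) * M.mMinus 0 - M.mMinus 0
      + (M.delta 0 * 0 + M.gamma 0 * 0) + (0 + 0) = treat x * M.directEffect := by
    rw [Model.directEffect]; ring
  rw [e] at main
  refine main.congr' ?_
  filter_upwards [hmem] with n hn
  have ht : treat (h n * x) = treat x := by
    rw [← treat_div (inv_pos.2 (h_pos n)) x, div_inv_eq_mul, mul_comm]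
  rw [(hYd n).eq' hn, ht]
  ring

end Rescaled

/-! ### Radius and bandwidth of the same order -/

/-- The difference between the local averages of `f` at the rescaled points `x / κ` and `0`. -/
noncomputable def smoothDiff (κ : ℝ) (f : ℝ → ℝ) (x : ℝ) : ℝ := smooth f (x / κ) - smooth f 0

lemma bddMeas_smoothDiff {f : ℝ → ℝ} (hf : BddMeas f) (κ : ℝ) : BddMeas (smoothDiff κ f) := by
  obtain ⟨hm, B, hB⟩ := hf.smooth
  refine ⟨(hm.comp (measurable_id.div_const κ)).sub_const _, B + B, fun a => ?_⟩
  exact (abs_sub _ _).trans (add_le_add (hB _) (hB _))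

lemma smoothDiff_neg {κ C : ℝ} {f : ℝ → ℝ} (h : ∀ a, smooth f (-a) = C - smooth f a) (x : ℝ) :
    smoothDiff κ f (-x) = -smoothDiff κ f x := by
  have h0 := h 0
  rw [neg_zero] at h0
  rw [smoothDiff, smoothDiff, neg_div, h]
  linarith

lemma LamPlus_eq {K f : ℝ → ℝ} {κ : ℝ} (hκ : 0 < κ) (hf : BddMeas f) (p : ℕ) :
    LamPlus K (2 * κ) f p = ∫ x in (0 : ℝ)..1, x ^ p * smoothDiff κ f x * K x := by
  refine intervalIntegral.integral_congr fun x hx => ?_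
  rw [uIcc_of_le zero_le_one] at hx
  rw [contrast_eq (by positivity) hf hx.1, mul_div_mul_left _ _ two_ne_zero]
  rfl

/-- `contrast` only describes the treated side; by reflection symmetry `smoothDiff` is odd, which
accounts for the two minus signs in `LamMinus`. -/
lemma LamMinus_eq {K f : ℝ → ℝ} {κ C : ℝ} (hκ : 0 < κ) (hf : BddMeas f)
    (hsymm : ∀ a, smooth f (-a) = C - smooth f a) (p : ℕ) :
    LamMinus K (2 * κ) f p = ∫ x in (-1 : ℝ)..0, x ^ p * smoothDiff κ f x * K x := by
  refine intervalIntegral.integral_congr fun x hx => ?_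
  rw [uIcc_of_le (by norm_num)] at hx
  rw [contrast_eq (by positivity) hf (neg_nonneg.2 hx.2), mul_div_mul_left _ _ two_ne_zero]
  have := smoothDiff_neg (κ := κ) hsymm x
  rw [smoothDiff] at this
  rw [this, neg_neg]

lemma bddMeas_dTilde_div (κ : ℝ) : BddMeas fun x => dTilde (2 * x / (2 * κ)) := by
  obtain ⟨hm, B, hB⟩ := bddMeas_treat.smooth
  rw [smooth_treat] at hm hB
  exact ⟨hm.comp ((measurable_id.const_mul 2).div_const _), B, fun a => hB _⟩

lemma integral_linear_combination {k : ℝ → ℝ} {B : ℝ} (hk : IsWeight k B) {f₁ f₂ f₃ : ℝ → ℝ}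
    (h₁ : BddMeas f₁) (h₂ : BddMeas f₂) (h₃ : BddMeas f₃) (c₀ c₁ c₂ c₃ : ℝ) (p : ℕ) :
    ∫ x, x ^ p * (c₀ + c₁ * f₁ x + c₂ * f₂ x + c₃ * f₃ x) * k x =
      c₀ * mom k p + c₁ * (∫ x, x ^ p * f₁ x * k x) + c₂ * (∫ x, x ^ p * f₂ x * k x)
        + c₃ * ∫ x, x ^ p * f₃ x * k x := by
  have i : ∀ {f : ℝ → ℝ} (c : ℝ), BddMeas f → Integrable fun x => c * (x ^ p * f x * k x) :=
    fun c hf => (hk.integrable_mul p hf.1 hf.2.choose_spec).const_mul c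
  have i0 : Integrable fun x => c₀ * (x ^ p * k x) := (hk.integrable_mom p).const_mul c₀
  have i1 : Integrable fun x => c₀ * (x ^ p * k x) + c₁ * (x ^ p * f₁ x * k x) :=
    i0.add (i c₁ h₁)
  have i2 : Integrable fun x => c₀ * (x ^ p * k x) + c₁ * (x ^ p * f₁ x * k x)
      + c₂ * (x ^ p * f₂ x * k x) := i1.add (i c₂ h₂)
  rw [show (fun x => x ^ p * (c₀ + c₁ * f₁ x + c₂ * f₂ x + c₃ * f₃ x) * k x) = fun x =>
      c₀ * (x ^ p * k x) + c₁ * (x ^ p * f₁ x * k x) + c₂ * (x ^ p * f₂ x * k x)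
        + c₃ * (x ^ p * f₃ x * k x) by ext x; ring,
    integral_add i2 (i c₃ h₃), integral_add i1 (i c₂ h₂), integral_add i0 (i c₁ h₁)]
  simp only [integral_const_mul]
  rfl

/-- The intercept of the fit is linear in the moments and reproduces constants, here `τd` on the
treated and `0` on the control side. -/
lemma IsKernel.fit_sub_eq_tauStar {K : ℝ → ℝ} {Kbar : ℝ} (hK : IsKernel K Kbar) {κ : ℝ} (hκ : 0 < κ)
    {δ₀ : ℝ} (hδ : |δ₀| < 1) (τd γ₀ : ℝ) :
    fitPlus K (fun p => ∫ x in (0 : ℝ)..1, x ^ p * (τd + δ₀ * τd * smoothDiff κ (lam δ₀) x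
        + δ₀ * γ₀ * smoothDiff κ (lamTilde δ₀) x + γ₀ * dTilde (2 * x / (2 * κ))) * K x)
      - fitMinus K (fun p => ∫ x in (-1 : ℝ)..0, x ^ p * (0 + δ₀ * τd * smoothDiff κ (lam δ₀) x
        + δ₀ * γ₀ * smoothDiff κ (lamTilde δ₀) x + γ₀ * dTilde (2 * x / (2 * κ))) * K x)
      = tauStar K (2 * κ) τd δ₀ γ₀ := by
  have hp := hK.isWeight_indicator (s := Ici 0) measurableSet_Ici
  have hm := hK.isWeight_indicator (s := Iio 0) measurableSet_Iio
  have dp := hp.det_pos hK.mom_pos.1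
  have dm := hm.det_pos hK.mom_pos.2
  rw [hK.mom_indicator_Ici] at dp
  rw [hK.mom_indicator_Iio] at dm
  have b1 := bddMeas_smoothDiff (bddMeas_lam hδ) κ
  have b2 := bddMeas_smoothDiff (bddMeas_lamTilde hδ) κ
  have b3 := bddMeas_dTilde_div κ
  have s1 : ∀ a, smooth (lam δ₀) (-a) = (1 - δ₀)⁻¹ - smooth (lam δ₀) a := by
    rw [smooth_lam hδ]; exact lamTilde_neg hδ
  have s2 := smooth_neg_of_symm (bddMeas_lamTilde hδ) (lamTilde_neg hδ)
  have ep : ∀ p, ∫ x in (0 : ℝ)..1, x ^ p * (τd + δ₀ * τd * smoothDiff κ (lam δ₀) x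
        + δ₀ * γ₀ * smoothDiff κ (lamTilde δ₀) x + γ₀ * dTilde (2 * x / (2 * κ))) * K x
      = τd * momPlus K p + δ₀ * τd * LamPlus K (2 * κ) (lam δ₀) p
        + δ₀ * γ₀ * LamPlus K (2 * κ) (lamTilde δ₀) p + γ₀ * GamPlus K (2 * κ) p := by
    intro p
    have := integral_linear_combination hp b1 b2 b3 τd (δ₀ * τd) (δ₀ * γ₀) γ₀ p
    simp only [hK.mom_indicator_Ici, hK.integral_indicator_Ici fun x => x ^ p * _] at this
    rw [LamPlus_eq hκ (bddMeas_lam hδ), LamPlus_eq hκ (bddMeas_lamTilde hδ), GamPlus]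
    exact this
  have em : ∀ p, ∫ x in (-1 : ℝ)..0, x ^ p * (0 + δ₀ * τd * smoothDiff κ (lam δ₀) x
        + δ₀ * γ₀ * smoothDiff κ (lamTilde δ₀) x + γ₀ * dTilde (2 * x / (2 * κ))) * K x
      = 0 * momMinus K p + δ₀ * τd * LamMinus K (2 * κ) (lam δ₀) p
        + δ₀ * γ₀ * LamMinus K (2 * κ) (lamTilde δ₀) p + γ₀ * GamMinus K (2 * κ) p := by
    intro p
    have := integral_linear_combination hm b1 b2 b3 0 (δ₀ * τd) (δ₀ * γ₀) γ₀ p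
    simp only [hK.mom_indicator_Iio, hK.integral_indicator_Iio fun x => x ^ p * _] at this
    rw [LamMinus_eq hκ (bddMeas_lam hδ) s1, LamMinus_eq hκ (bddMeas_lamTilde hδ) s2, GamMinus]
    exact this
  simp only [tauStar, fitPlus, fitMinus, ep, em]
  have dp' := dp.ne'
  have dm' := dm.ne'
  field_simp
  ring

end RDSpillover

/-! ### The three regimes -/

theorem theorem1
    (M : Model) (C : ℝ≥0) (Cδ Cγ δbar : ℝ) (hM : M.Regular C Cδ Cγ δbar)
    (K : ℝ → ℝ) (Kbar : ℝ) (hK : IsKernel K Kbar)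
    (h r : ℕ → ℝ) (h_pos : ∀ n, 0 < h n) (r_pos : ∀ n, 0 < r n)
    (h_zero : Tendsto h atTop (𝓝 0)) (nh_top : Tendsto (fun n : ℕ => (n : ℝ) * h n) atTop atTop)
    (Yd : ℕ → ℝ → ℝ) (hYd : ∀ n, M.IsOutcome (r n) treat (Yd n))
    {Ω : Type*} [MeasurableSpace Ω] (P : Measure Ω) [IsProbabilityMeasure P]
    (σ : ℝ) (Y Z ε : (n : ℕ) → Fin n → Ω → ℝ)
    (hS : ∀ n, IsSample P (Yd n) σ (Y n) (Z n) (ε n))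
    (τhat : ℕ → Ω → ℝ)
    (hτ : ∀ n ω, IsRDDEstimate K (h n) (fun i => Y n i ω) (fun i => Z n i ω) (τhat n ω)) :
    (Tendsto (fun n => r n / h n) atTop atTop →
      TendstoInMeasure P τhat atTop (fun _ => M.directEffect)) ∧
    (Tendsto (fun n => r n / h n) atTop (𝓝 0) →
      TendstoInMeasure P τhat atTop
        (fun _ => (M.directEffect + M.gamma 0) / (1 - M.delta 0)) ∧
      ∀ Yall Ynone : ℕ → ℝ → ℝ,
        (∀ n, M.IsOutcome (r n) treatAll (Yall n)) →
        (∀ n, M.IsOutcome (r n) treatNone (Ynone n)) →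
        Tendsto (fun n => M.totalEffect (r n) (Yall n) (Ynone n)) atTop
          (𝓝 ((M.directEffect + M.gamma 0) / (1 - M.delta 0)))) ∧
    (∀ κ : ℝ, 0 < κ → Tendsto (fun n => r n / h n) atTop (𝓝 κ) →
      TendstoInMeasure P τhat atTop
        (fun _ => tauStar K (2 * κ) M.directEffect (M.delta 0) (M.gamma 0))) := by
  obtain ⟨B, B0, hB⟩ := hM.outcome_bounded
  have hB' : ∀ n, ∀ z ∈ agents, |Yd n z| ≤ B := fun n =>
    hB _ _ _ (r_pos n) treat_nonneg treat_le_one (hYd n)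
  have hδ : |M.delta 0| < 1 := (hM.delta_le 0 zero_mem_agents).trans_lt hM.δbar_lt_one
  have hδ1 : 1 - M.delta 0 ≠ 0 := by linarith [(abs_lt.1 hδ).2]
  have r_zero : ∀ κ : ℝ, Tendsto (fun n => r n / h n) atTop (𝓝 κ) → Tendsto r atTop (𝓝 0) := by
    intro κ hκ
    have := hκ.mul h_zero
    rw [mul_zero] at this
    exact this.congr fun n => div_mul_cancel₀ _ (h_pos n).ne'
  refine ⟨fun hr => ?_, fun hr => ⟨?_, fun Yall Ynone hall hnone =>
    hM.tendsto_totalEffect r_pos (r_zero 0 hr) hall hnone⟩, fun κ hκ hr => ?_⟩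
  · have hlim := hM.tendsto_outcome_of_large_radius h_pos r_pos h_zero hr hYd
    have hA : ∀ n, |M.mMinus 0 + M.delta 0 * nbhdMean (r n) (Yd n) 0
        + M.gamma 0 * nbhdMean (r n) treat 0| ≤ |M.mMinus 0| + |M.delta 0| * B + |M.gamma 0| * 1 := by
      intro n
      refine (abs_add_three _ _ _).trans ?_
      rw [abs_mul, abs_mul]
      gcongr
      · exact abs_nbhdMean_le (r_pos n) zero_mem_agents (hB' n)
      · exact abs_nbhdMean_le (r_pos n) zero_mem_agents fun u _ => abs_le.2
          ⟨by linarith [treat_nonneg u], treat_le_one u⟩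
    have := rdd_tendstoInMeasure hK h_pos h_zero nh_top hS (fun n => (hYd n).integrable) hτ hB' hA
      (LP := fun _ => M.directEffect) (LM := fun _ => 0)
      (fun x hx => by simpa [treat_of_nonneg hx.le] using hlim x)
      (fun x hx => by simpa [treat_of_neg hx] using hlim x)
    rwa [hK.fitPlus_const, hK.fitMinus_const, sub_zero] at this
  · have hinv : Tendsto (fun n => h n / r n) atTop atTop := by
      have : Tendsto (fun n => r n / h n) atTop (𝓝[>] 0) := tendsto_nhdsWithin_iff.2
        ⟨hr, Eventually.of_forall fun n => div_pos (r_pos n) (h_pos n)⟩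
      exact (tendsto_inv_nhdsGT_zero.comp this).congr fun n => inv_div _ _
    have := rdd_tendstoInMeasure hK h_pos h_zero nh_top hS (fun n => (hYd n).integrable) hτ hB'
      (a := fun _ => 0) (A := 0) (by simp)
      (LP := fun _ => (M.mMinus 0 + M.directEffect + M.gamma 0) / (1 - M.delta 0))
      (LM := fun _ => M.mMinus 0 / (1 - M.delta 0))
      (fun x hx => by
        have hx' : Tendsto (fun n => h n * x / r n) atTop atTop :=
          (hinv.atTop_mul_const hx).congr fun n => div_mul_eq_mul_div _ _ _
        have := hM.tendsto_rescaled h_pos r_pos h_zero (r_zero 0 hr) hYd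
          ((tendsto_lamTilde_atTop hδ).comp hx')
        simp only [sub_zero]
        convert this using 2
        rw [treat_of_nonneg hx.le]
        field_simp
        ring)
      (fun x hx => by
        have hx' : Tendsto (fun n => h n * x / r n) atTop atBot :=
          (hinv.atTop_mul_const_of_neg hx).congr fun n => div_mul_eq_mul_div _ _ _
        have := hM.tendsto_rescaled h_pos r_pos h_zero (r_zero 0 hr) hYd
          ((tendsto_lamTilde_atBot hδ).comp hx')
        simpa [treat_of_neg hx] using this)
    rw [hK.fitPlus_const, hK.fitMinus_const, ← sub_div] at this
    convert this using 3
    ring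
  · have hinv : ∀ x, Tendsto (fun n => lamTilde (M.delta 0) (h n * x / r n)) atTop
        (𝓝 (lamTilde (M.delta 0) (x / κ))) := fun x => by
      have h1 : Tendsto (fun n => h n * x / r n) atTop (𝓝 (x / κ)) :=
        ((hr.inv₀ hκ.ne').const_mul x).congr fun n => by rw [inv_div]; ring
      exact ((continuous_lamTilde hδ).tendsto _).comp h1
    -- The centring collects the control level and the averages at `0`, so that the averages at `x /
    -- κ` become `smoothDiff`. One use of `lamTilde_eq` splits the `gamma` term into `dTilde` and a
    -- further average.
    set α := M.mMinus 0 / (1 - M.delta 0)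
      + M.delta 0 * M.directEffect * smooth (lam (M.delta 0)) 0
      + M.delta 0 * M.gamma 0 * smooth (lamTilde (M.delta 0)) 0 with hα
    have hlim : ∀ x, Tendsto (fun n => Yd n (h n * x) - α) atTop
        (𝓝 (treat x * M.directEffect
          + M.delta 0 * M.directEffect * smoothDiff κ (lam (M.delta 0)) x
          + M.delta 0 * M.gamma 0 * smoothDiff κ (lamTilde (M.delta 0)) x
          + M.gamma 0 * dTilde (2 * x / (2 * κ)))) := fun x => by
      convert (hM.tendsto_rescaled h_pos r_pos h_zero (r_zero κ hr) hYd (hinv x)).sub_const α using 2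
      have e := lamTilde_eq hδ (x / κ)
      rw [hα, smoothDiff, smoothDiff, mul_div_mul_left _ _ two_ne_zero, smooth_lam hδ]
      linear_combination -M.gamma 0 * e
    rw [← hK.fit_sub_eq_tauStar hκ hδ]
    exact rdd_tendstoInMeasure hK h_pos h_zero nh_top hS (fun n => (hYd n).integrable) hτ hB'
      (a := fun _ => α) (A := |α|) (fun _ => le_rfl)
      (fun x hx => by simpa only [treat_of_nonneg hx.le, one_mul] using hlim x)
      (fun x hx => by simpa only [treat_of_neg hx, zero_mul] using hlim x)
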